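/- Let $(\mathcal R,\mu)$ and $(\mathcal S,\nu)$ be non-atomic $\sigma$-finite measure spaces; $f^*(t)=\inf\{\lambda\ge 0:\mu(\{|f|>\lambda\})\le t\}$, $t>0$, denotes the non-increasing rearrangement. Let $1<p_0<q<\infty$, $1<p_1<\infty$, $1\le q_0<\infty$ and $r=\frac{p_0q}{p_1(q-p_0)}$. Lorentz spaces are given by $$\|f\|_{L^{a,b}}=\Big(\int_0^\infty t^{\frac ba-1}f^*(t)^b\,dt\Big)^{1/b}\ (b<\infty),\qquad \|f\|_{L^{a,\infty}}=\sup_{t>0}t^{1/a}f^*(t).$$ Let $X=X(\mathcal R,\mu)$ and $Y=Y(\mathcal S,\nu)$ be rearrangement-invariant Banach function spaces, with representation spaces $\bar X$ over $(0,\mu(\mathcal R))$ and $\bar Y$ over $(0,\nu(\mathcal S))$ (so that $\|f\|_X=\|f^*\|_{\bar X}$ and $\|g\|_Y=\|g^*\|_{\bar Y}$), and suppose that $X\subset (L^{p_0,q_0}+L^{q,1})(\mathcal R,\mu)$. Let $Y^{\langle p_1,\infty\rangle}(\mathcal S,\nu)$ be the set of measurable $g$ with $$\|g\|_{Y^{\langle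 p_1,\infty\rangle}}=\Big\|t^{-\frac1{p_1}}\sup_{0<s\le t}s^{\frac1{p_1}}g^*(s)\Big\|_{\bar Y(0,\nu(\mathcal S))}<\infty ,$$ and for nonnegative measurable $f$ on $(0,\mu(\mathcal R))$ and $t>0$ put $$R_{q_0}f(t)=t^{-\frac1{p_1}}\Big(\int_0^{t^r}s^{\frac{q_0}{p_0}-1}f^*(s)^{q_0}\,ds\Big)^{\frac1{q_0}},\qquad Sf(t)=\int_{t^r}^\infty s^{\frac1q-1}f^*(s)\,ds .$$ A map $T$ from $(L^{p_0,q_0}+L^{q,1})(\mathcal R,\mu)$ to the measurable functions on $(\mathcal S,\nu)$ is called quasilinear if there is $k\ge1$ such that $|T(f+g)|\le k(|Tf|+|Tg|)$ and $|T(af)|=|a|\,|Tf|$ $\nu$-a.e. for all $f,g$ in its domain and all $a\in\mathbb R$; it is called sublinear if this holds with $k=1$. Boundedness $T\colon A\to B$ means $\|Tf\|_B\le C\|f\|_A$ for all $f\in A$, with a finite constant $C$ independent of $f$. Then the following three statements are equivalent. (i) Every sublinear operator $T$ with $T\colon L^{p_0,q_0}(\mathcal R,\mu)\to L^{p_1,\infty}(\mathcal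 S,\nu)$ and $T\colon L^{q,1}(\mathcal R,\mu)\to L^\infty(\mathcal S,\nu)$ is bounded from $X(\mathcal R,\mu)$ to $Y^{\langle p_1,\infty\rangle}(\mathcal S,\nu)$. (ii) Every quasilinear operator $T$ with these two mapping properties is bounded from $X(\mathcal R,\mu)$ to $Y^{\langle p_1,\infty\rangle}(\mathcal S,\nu)$. (iii) The operators $R_{q_0}$ and $S$ are bounded from $\bar X(0,\mu(\mathcal R))$ to $\bar Y(0,\nu(\mathcal S))$. -/

import Mathlib

open MeasureTheory Set
open scoped ENNReal NNReal

noncomputable section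

namespace RI

/-- `μ` has no atoms: every measurable set of positive measure contains a measurable subset of
strictly smaller positive measure. -/
def Nonatomic {α : Type*} [MeasurableSpace α] (μ : Measure α) : Prop :=
  ∀ E : Set α, MeasurableSet E → 0 < μ E →
    ∃ F : Set α, MeasurableSet F ∧ F ⊆ E ∧ 0 < μ F ∧ μ F < μ E

/-- The non-increasing rearrangement `f^*(t) = inf {l ≥ 0 : μ {f > l} ≤ t}` of a nonnegative
function (used for `t > 0`). -/
def rearr {α : Type*} [MeasurableSpace α] (μ : Measure α) (f : α → ℝ≥0∞) (t : ℝ) : ℝ≥0∞ :=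
  sInf {l : ℝ≥0∞ | μ {x | l < f x} ≤ ENNReal.ofReal t}

/-- A rearrangement-invariant Banach function norm over `(α, μ)`. -/
structure RINorm {α : Type*} [MeasurableSpace α] (μ : Measure α) where
  /-- the functional; only its values at measurable functions matter -/
  toFun : (α → ℝ≥0∞) → ℝ≥0∞
  eq_zero_iff : ∀ f, Measurable f → (toFun f = 0 ↔ f =ᵐ[μ] 0)
  smul : ∀ (a : ℝ≥0) (f : α → ℝ≥0∞), Measurable f →
    toFun (fun x => (a : ℝ≥0∞) * f x) = a * toFun f
  add_le : ∀ f g, Measurable f → Measurable g →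
    toFun (fun x => f x + g x) ≤ toFun f + toFun g
  mono : ∀ f g, Measurable f → Measurable g → f ≤ᵐ[μ] g → toFun f ≤ toFun g
  fatou : ∀ (f : ℕ → α → ℝ≥0∞) (g : α → ℝ≥0∞), (∀ n, Measurable (f n)) → Measurable g →
    (∀ᵐ x ∂μ, Monotone (fun n => f n x)) → (∀ᵐ x ∂μ, ⨆ n, f n x = g x) →
    ⨆ n, toFun (f n) = toFun g
  indicator_lt_top : ∀ E : Set α, MeasurableSet E → μ E < ∞ → toFun (E.indicator 1) < ∞
  lintegral_le : ∀ E : Set α, MeasurableSet E → μ E < ∞ →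
    ∃ C : ℝ≥0, ∀ f, Measurable f → ∫⁻ x in E, f x ∂μ ≤ C * toFun f
  rearr_eq : ∀ f g, Measurable f → Measurable g →
    (∀ t : ℝ, 0 < t → rearr μ f t = rearr μ g t) → toFun f = toFun g

/-- Lebesgue measure on the interval `(0, μ(α))`, as a measure on `ℝ`. -/
def halfLine {α : Type*} [MeasurableSpace α] (μ : Measure α) : Measure ℝ :=
  volume.restrict {t : ℝ | 0 < t ∧ ENNReal.ofReal t < μ univ}

/-- The norm of the representation space of `ρ` on `(0, μ(α))`: the value at `h` is `ρ g` for any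
`g` over `(α, μ)` with `g^* = h^*`. By rearrangement invariance all such `g` give the same value,
and such a `g` exists when `μ` is nonatomic and `σ`-finite. -/
def RINorm.repr {α : Type*} [MeasurableSpace α] {μ : Measure α} (ρ : RINorm μ)
    (h : ℝ → ℝ≥0∞) : ℝ≥0∞ :=
  ⨅ (g : α → ℝ≥0∞) (_ : Measurable g)
    (_ : ∀ t : ℝ, 0 < t → rearr μ g t = rearr (halfLine μ) h t), ρ.toFun g

/-- The norm `‖f‖_X = ρ(|f|)` of the rearrangement-invariant space `X = X(ρ)`. -/
def RINorm.norm {α : Type*} [MeasurableSpace α] {μ : Measure α} (ρ : RINorm μ)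
    (f : α →ₘ[μ] ℝ) : ℝ≥0∞ :=
  ρ.toFun (fun x => ‖f x‖ₑ)

/-- The rearrangement of the absolute value of a real function. -/
def rearrAbs {α : Type*} [MeasurableSpace α] {μ : Measure α} (f : α →ₘ[μ] ℝ) : ℝ → ℝ≥0∞ :=
  rearr μ (fun x => ‖f x‖ₑ)

/-- The Lorentz functional of `L^{p,q}`, `q < ∞`. -/
def lorentz {α : Type*} [MeasurableSpace α] {μ : Measure α} (p q : ℝ) (f : α →ₘ[μ] ℝ) : ℝ≥0∞ :=
  (∫⁻ t in Ioi (0 : ℝ), ENNReal.ofReal (t ^ (q / p - 1)) * rearrAbs f t ^ q) ^ (1 / q)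

/-- The Lorentz functional of `L^{p,∞}`. -/
def weakLorentz {α : Type*} [MeasurableSpace α] {μ : Measure α} (p : ℝ) (f : α →ₘ[μ] ℝ) : ℝ≥0∞ :=
  ⨆ (t : ℝ) (_ : 0 < t), ENNReal.ofReal (t ^ (1 / p)) * rearrAbs f t

/-- The norm of `L^∞`. -/
def supNorm {α : Type*} [MeasurableSpace α] {μ : Measure α} (f : α →ₘ[μ] ℝ) : ℝ≥0∞ :=
  eLpNorm f ∞ μ

/-- The space `L^{p₀,q₀} + L^{q,1}`. -/
def lorentzSum {α : Type*} [MeasurableSpace α] (μ : Measure α) (p₀ q₀ q : ℝ) :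
    Set (α →ₘ[μ] ℝ) :=
  {f | ∃ f₀ f₁ : α →ₘ[μ] ℝ, lorentz p₀ q₀ f₀ < ∞ ∧ lorentz q 1 f₁ < ∞ ∧ f = f₀ + f₁}

/-- The functional of `Y^{⟨p,∞⟩}`:
`‖ t^{-1/p} sup_{0 < s ≤ t} s^{1/p} f^*(s) ‖` in the representation space of `Y`. -/
def RINorm.angleNorm {β : Type*} [MeasurableSpace β] {ν : Measure β} (ρ : RINorm ν) (p : ℝ)
    (f : β →ₘ[ν] ℝ) : ℝ≥0∞ :=
  ρ.repr (fun t => ENNReal.ofReal (t ^ (-(1 / p))) *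
    ⨆ (s : ℝ) (_ : 0 < s ∧ s ≤ t), ENNReal.ofReal (s ^ (1 / p)) * rearrAbs f s)

/-- The exponent `r = p₀ q / (p₁ (q - p₀))`. -/
def slope (p₀ p₁ q : ℝ) : ℝ := p₀ * q / (p₁ * (q - p₀))

/-- `R_{q₀} f(t) = t^{-1/p₁} (∫_0^{t^r} s^{q₀/p₀-1} f^*(s)^{q₀} ds)^{1/q₀}` for `f` on an interval
`(0, a)` with Lebesgue measure `m`; `f^*` vanishes on `[a, ∞)`. -/
def calderonR (m : Measure ℝ) (p₀ q₀ p₁ q : ℝ) (f : ℝ → ℝ≥0∞) (t : ℝ) : ℝ≥0∞ :=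
  ENNReal.ofReal (t ^ (-(1 / p₁))) *
    (∫⁻ s in Ioo (0 : ℝ) (t ^ slope p₀ p₁ q),
      ENNReal.ofReal (s ^ (q₀ / p₀ - 1)) * rearr m f s ^ q₀) ^ (1 / q₀)

/-- `S f(t) = ∫_{t^r}^∞ s^{1/q-1} f^*(s) ds`, with `f` and `m` as for `calderonR`. -/
def calderonS (m : Measure ℝ) (p₀ p₁ q : ℝ) (f : ℝ → ℝ≥0∞) (t : ℝ) : ℝ≥0∞ :=
  ∫⁻ s in Ioi (t ^ slope p₀ p₁ q), ENNReal.ofReal (s ^ (1 / q - 1)) * rearr m f s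

/-- `‖T f‖_B ≤ C ‖f‖_A` for all `f` with `‖f‖_A < ∞`, for some finite constant `C`. -/
def BoundedFrom {V W : Type*} (normA : V → ℝ≥0∞) (normB : W → ℝ≥0∞) (T : V → W) : Prop :=
  ∃ C : ℝ≥0, ∀ f : V, normA f < ∞ → normB (T f) ≤ C * normA f

/-- `T`, with domain `D` (its values outside `D` carry no meaning), satisfies
`|T(f+g)| ≤ k (|Tf| + |Tg|)` and `|T(af)| = |a| |Tf|` almost everywhere. -/
def QuasilinearWith {α β : Type*} [MeasurableSpace α] [MeasurableSpace β] {μ : Measure α}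
    {ν : Measure β} (k : ℝ) (D : Set (α →ₘ[μ] ℝ)) (T : (α →ₘ[μ] ℝ) → (β →ₘ[ν] ℝ)) : Prop :=
  (∀ f ∈ D, ∀ g ∈ D, ∀ᵐ y ∂ν, |T (f + g) y| ≤ k * (|T f y| + |T g y|)) ∧
  (∀ (a : ℝ), ∀ f ∈ D, ∀ᵐ y ∂ν, |T (a • f) y| = |a| * |T f y|)

/-- Quasilinear operators with domain `D`. -/
def Quasilinear {α β : Type*} [MeasurableSpace α] [MeasurableSpace β] {μ : Measure α}
    {ν : Measure β} (D : Set (α →ₘ[μ] ℝ)) (T : (α →ₘ[μ] ℝ) → (β →ₘ[ν] ℝ)) : Prop :=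
  ∃ k : ℝ, 1 ≤ k ∧ QuasilinearWith k D T

/-- Sublinear operators with domain `D`. -/
def Sublinear {α β : Type*} [MeasurableSpace α] [MeasurableSpace β] {μ : Measure α}
    {ν : Measure β} (D : Set (α →ₘ[μ] ℝ)) (T : (α →ₘ[μ] ℝ) → (β →ₘ[ν] ℝ)) : Prop :=
  QuasilinearWith 1 D T

/-- The endpoint estimates `T : L^{p₀,q₀} → L^{p₁,∞}` and `T : L^{q,1} → L^∞`. -/
def EndpointBounds {α β : Type*} [MeasurableSpace α] [MeasurableSpace β] {μ : Measure α}
    {ν : Measure β} (p₀ q₀ p₁ q : ℝ) (T : (α →ₘ[μ] ℝ) → (β →ₘ[ν] ℝ)) : Prop :=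
  BoundedFrom (lorentz p₀ q₀) (weakLorentz p₁) T ∧ BoundedFrom (lorentz q 1) supNorm T

/-- Boundedness of an operator on nonnegative functions between the representation spaces of
`ρX` and `ρY`. -/
def BoundedRepr {α β : Type*} [MeasurableSpace α] [MeasurableSpace β] {μ : Measure α}
    {ν : Measure β} (ρX : RINorm μ) (ρY : RINorm ν) (A : (ℝ → ℝ≥0∞) → (ℝ → ℝ≥0∞)) : Prop :=
  ∃ C : ℝ≥0, ∀ f : ℝ → ℝ≥0∞, Measurable f → ρX.repr f < ∞ → ρY.repr (A f) ≤ C * ρX.repr f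

end RI

end

/-!
For the sufficiency of the bounds on `R` and `S`, cut `f` at the level `f^*(t^r)`: the part above
the level lies in `L^{p₀,q₀}` with norm at most `t^{1/p₁} R f^*(t)`, and the truncation lies in
`L^{q,1}` with norm at most a constant times `R f^*(t) + S f^*(t)`. The endpoint estimates for `T`
then give `t^{-1/p₁} sup_{s ≤ t} s^{1/p₁} (T f)^*(s) ≤ C (R f^*(t) + S f^*(t))`.

For the necessity, nonatomicity provides a measure-preserving map onto the interval `(0, μ(α))`.
The rearrangement is not subadditive, but the averages of `|f|` over the preimages of `(0, s)` are
additive in `|f|` and dominated by the averages of `f^*`. With these averages in place of `f^*`,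
`R` and `S` become sublinear operators, which satisfy the endpoint estimates by Hardy's inequality.
On the pull-back of `f^*` the averages dominate `f^*`, so that the bounds for these operators yield
the bounds for `R` and `S`.
-/

noncomputable section

namespace RI

/-! ### Measure-preserving maps from nonatomic spaces to intervals -/

section MeasureChain

variable {α : Type*} [MeasurableSpace α] {μ : Measure α}

/-- Inclusion with strict growth of the measure. Chains for this relation contain at most one set
of each measure. -/
def StrictlyBelow (μ : Measure α) (E F : Set α) : Prop := E ⊆ F ∧ μ E < μ F

/-- A maximal chain, for `StrictlyBelow μ`, of measurable sets of finite measure. Maximality says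
that no such set is strictly comparable to all members. -/
structure IsMeasureChain (μ : Measure α) (M : Set (Set α)) : Prop where
  measurableSet : ∀ E ∈ M, MeasurableSet E
  measure_lt_top : ∀ E ∈ M, μ E < ∞
  isChain : IsChain (StrictlyBelow μ) M
  exists_not_strictlyBelow : ∀ A, MeasurableSet A → μ A < ∞ →
    ∃ F ∈ M, ¬StrictlyBelow μ F A ∧ ¬StrictlyBelow μ A F

theorem exists_isMeasureChain (μ : Measure α) : ∃ M, IsMeasureChain μ M := by
  let r (E F : {E : Set α // MeasurableSet E ∧ μ E < ∞}) : Prop := StrictlyBelow μ E F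
  have hmax : IsMaxChain r (maxChain r) := maxChain_spec
  refine ⟨Subtype.val '' maxChain r, ⟨?_, ?_, ?_, ?_⟩⟩
  · rintro _ ⟨E, -, rfl⟩
    exact E.2.1
  · rintro _ ⟨E, -, rfl⟩
    exact E.2.2
  · exact IsChain.image_of_map_rel r (StrictlyBelow μ) Subtype.val (fun _ _ h => h) hmax.1
  · intro A hA hA'
    by_contra! hcomp
    have hchain : IsChain r (insert ⟨A, hA, hA'⟩ (maxChain r)) :=
      hmax.1.insert fun F hF _ => or_iff_not_imp_right.2 (hcomp F ⟨F, hF, rfl⟩)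
    have hmem : ⟨A, hA, hA'⟩ ∈ maxChain r :=
      hmax.2 hchain (subset_insert _ _) ▸ mem_insert _ _
    have hirrefl : ¬StrictlyBelow μ A A := fun h => h.2.false
    exact hirrefl (hcomp A ⟨_, hmem, rfl⟩ hirrefl)

namespace IsMeasureChain

variable {M : Set (Set α)} {E F A U : Set α} {t : ℝ≥0∞}

theorem subset_of_measure_le (hM : IsMeasureChain μ M) (hE : E ∈ M) (hF : F ∈ M)
    (h : μ E ≤ μ F) : E ⊆ F := by
  rcases eq_or_ne E F with rfl | hne
  · exact Subset.rfl
  · exact ((hM.isChain hE hF hne).resolve_right fun h' => h'.2.not_ge h).1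

theorem exists_measure_eq_zero (hM : IsMeasureChain μ M) : ∃ E ∈ M, μ E = 0 := by
  obtain ⟨E, hE, -, h⟩ := hM.exists_not_strictlyBelow ∅ .empty (by simp)
  exact ⟨E, hE, by simpa [StrictlyBelow] using h⟩

theorem exists_greatest_measure_le (hM : IsMeasureChain μ M) (ht : t ≠ ∞) :
    ∃ A ∈ M, μ A ≤ t ∧ ∀ E ∈ M, μ E ≤ t → μ E ≤ μ A := by
  by_contra! hcon
  let L := {E | E ∈ M ∧ μ E ≤ t}
  have hL : (μ '' L).Nonempty := by
    obtain ⟨E, hE, hE0⟩ := hM.exists_measure_eq_zero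
    exact ⟨_, E, ⟨hE, hE0.trans_le zero_le⟩, rfl⟩
  obtain ⟨u, hu_mono, hu_lim, hu⟩ := exists_seq_tendsto_sSup hL (OrderTop.bddAbove _)
  choose E hE hEu using hu
  have hcofinal : ∀ F ∈ M, μ F ≤ t → ∃ n, μ F < μ (E n) := by
    intro F hF hFt
    obtain ⟨G, hG, hGt, hFG⟩ := hcon F hF hFt
    have hlt : μ F < sSup (μ '' L) := hFG.trans_le (le_sSup ⟨G, ⟨hG, hGt⟩, rfl⟩)
    obtain ⟨n, hn⟩ := (hu_lim.eventually (lt_mem_nhds hlt)).exists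
    exact ⟨n, by rwa [hEu]⟩
  have hE_mono : Monotone E := fun m n hmn =>
    hM.subset_of_measure_le (hE m).1 (hE n).1 (by rw [hEu, hEu]; exact hu_mono hmn)
  have hUt : μ (⋃ n, E n) ≤ t := by
    rw [hE_mono.measure_iUnion]
    exact iSup_le fun n => (hE n).2
  obtain ⟨F, hF, hFU, hUF⟩ := hM.exists_not_strictlyBelow (⋃ n, E n)
    (.iUnion fun n => hM.measurableSet _ (hE n).1) (hUt.trans_lt ht.lt_top)
  rcases le_or_gt (μ F) t with hFt | htF
  · obtain ⟨n, hn⟩ := hcofinal F hF hFt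
    exact hFU ⟨(hM.subset_of_measure_le hF (hE n).1 hn.le).trans (subset_iUnion _ _),
      hn.trans_le (measure_mono (subset_iUnion _ _))⟩
  · exact hUF ⟨iUnion_subset fun n => hM.subset_of_measure_le (hE n).1 hF ((hE n).2.trans htF.le),
      hUt.trans_lt htF⟩

theorem exists_least_le_measure (hM : IsMeasureChain μ M) (ht : ∃ E ∈ M, t ≤ μ E) :
    ∃ A ∈ M, t ≤ μ A ∧ ∀ E ∈ M, t ≤ μ E → μ A ≤ μ E := by
  by_contra! hcon
  let L := {E | E ∈ M ∧ t ≤ μ E}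
  have hL : (μ '' L).Nonempty := Nonempty.image μ ht
  obtain ⟨u, hu_anti, hu_lim, hu⟩ := exists_seq_tendsto_sInf hL (OrderBot.bddBelow _)
  choose E hE hEu using hu
  have hcoinitial : ∀ F ∈ M, t ≤ μ F → ∃ n, μ (E n) < μ F := by
    intro F hF htF
    obtain ⟨G, hG, htG, hGF⟩ := hcon F hF htF
    have hlt : sInf (μ '' L) < μ F :=
      sInf_lt_iff.2 ⟨μ G, ⟨G, ⟨hG, htG⟩, rfl⟩, hGF⟩
    obtain ⟨n, hn⟩ := (hu_lim.eventually (gt_mem_nhds hlt)).exists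
    exact ⟨n, by rwa [hEu]⟩
  have hE_anti : Antitone E := fun m n hmn =>
    hM.subset_of_measure_le (hE n).1 (hE m).1 (by rw [hEu, hEu]; exact hu_anti hmn)
  have hE_meas (n : ℕ) : MeasurableSet (E n) := hM.measurableSet _ (hE n).1
  have htI : t ≤ μ (⋂ n, E n) := by
    rw [hE_anti.measure_iInter (fun n => (hE_meas n).nullMeasurableSet)
      ⟨0, (hM.measure_lt_top _ (hE 0).1).ne⟩]
    exact le_iInf fun n => (hE n).2
  obtain ⟨F, hF, hFI, hIF⟩ := hM.exists_not_strictlyBelow (⋂ n, E n) (.iInter hE_meas)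
    ((measure_mono (iInter_subset _ 0)).trans_lt (hM.measure_lt_top _ (hE 0).1))
  rcases le_or_gt t (μ F) with htF | hFt
  · obtain ⟨n, hn⟩ := hcoinitial F hF htF
    exact hIF ⟨(iInter_subset _ _).trans (hM.subset_of_measure_le (hE n).1 hF hn.le),
      (measure_mono (iInter_subset _ _)).trans_lt hn⟩
  · exact hFI ⟨subset_iInter fun n => hM.subset_of_measure_le hF (hE n).1 (hFt.le.trans (hE n).2),
      hFt.trans_le htI⟩

theorem exists_mem_measure_gt (hμ : Nonatomic μ) (hM : IsMeasureChain μ M) (hA : A ∈ M)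
    (hU : MeasurableSet U) (hAU : A ⊆ U) (hlt : μ A < μ U) :
    ∃ G ∈ M, μ A < μ G ∧ ¬(U ⊆ G ∧ μ U ≤ μ G) := by
  have hAm := hM.measurableSet A hA
  have hAfin := (hM.measure_lt_top A hA).ne
  have hdiff : μ (U \ A) = μ U - μ A := measure_sdiff hAU hAm.nullMeasurableSet hAfin
  obtain ⟨F, hF, hFU, hF0, hF_lt⟩ := hμ (U \ A) (hU.diff hAm)
    (by rw [hdiff]; exact tsub_pos_of_lt hlt)
  have hAF : μ (A ∪ F) = μ A + μ F :=
    measure_union (disjoint_sdiff_right.mono_right hFU) hF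
  have hA_lt : μ A < μ (A ∪ F) := by
    rw [hAF]
    exact ENNReal.lt_add_right hAfin hF0.ne'
  have hlt_U : μ (A ∪ F) < μ U := by
    rw [hAF, add_comm]
    exact lt_tsub_iff_right.1 (hdiff ▸ hF_lt)
  have hsub_U : A ∪ F ⊆ U := union_subset hAU (hFU.trans sdiff_subset)
  obtain ⟨G, hG, hGAF, hAFG⟩ := hM.exists_not_strictlyBelow _ (hAm.union hF) hlt_U.lt_top
  refine ⟨G, hG, ?_, fun h => hAFG ⟨hsub_U.trans h.1, hlt_U.trans_le h.2⟩⟩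
  by_contra! hGA
  exact hGAF ⟨(hM.subset_of_measure_le hG hA hGA).trans subset_union_left, hGA.trans_lt hA_lt⟩

theorem exists_measure_eq (hμ : Nonatomic μ) (hM : IsMeasureChain μ M) (ht : t < μ univ) :
    ∃ E ∈ M, μ E = t := by
  obtain ⟨A, hA, hAt, hA_max⟩ := hM.exists_greatest_measure_le ht.ne_top
  have hgt : ∀ G ∈ M, μ A < μ G → t < μ G := fun G hG h => by
    by_contra! hGt
    exact h.not_ge (hA_max G hG hGt)
  refine ⟨A, hA, hAt.antisymm ?_⟩
  by_contra! hAt'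
  by_cases hge : ∃ E ∈ M, t ≤ μ E
  · obtain ⟨B, hB, htB, hB_min⟩ := hM.exists_least_le_measure hge
    have hAB : μ A < μ B := hAt'.trans_le htB
    obtain ⟨G, hG, hAG, hBG⟩ := hM.exists_mem_measure_gt hμ hA (hM.measurableSet B hB)
      (hM.subset_of_measure_le hA hB hAB.le) hAB
    have hle : μ B ≤ μ G := hB_min G hG (hgt G hG hAG).le
    exact hBG ⟨hM.subset_of_measure_le hB hG hle, hle⟩
  · obtain ⟨G, hG, hAG, -⟩ :=
      hM.exists_mem_measure_gt hμ hA .univ (subset_univ A) (hAt'.trans ht)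
    exact hge ⟨G, hG, (hgt G hG hAG).le⟩

end IsMeasureChain

/-- The least measure of a member of the family `E` that contains `x` (`∞` if there is none). For a
rich enough chain `E` it maps `μ` to Lebesgue measure. -/
def chainLevel {ι : Type*} (μ : Measure α) (E : ι → Set α) (x : α) : ℝ≥0∞ :=
  ⨅ (i) (_ : x ∈ E i), μ (E i)

theorem setOf_chainLevel_lt {ι : Type*} (E : ι → Set α) (t : ℝ≥0∞) :
    {x | chainLevel μ E x < t} = ⋃ i ∈ {i | μ (E i) < t}, E i := by
  ext x
  simp [chainLevel, iInf_lt_iff, and_comm]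

theorem measurable_chainLevel {ι : Type*} [Countable ι] {E : ι → Set α}
    (hE : ∀ i, MeasurableSet (E i)) : Measurable (chainLevel μ E) :=
  measurable_of_Iio fun t => by
    change MeasurableSet {x | chainLevel μ E x < t}
    rw [setOf_chainLevel_lt]
    exact .biUnion (to_countable _) fun i _ => hE i

theorem Nonatomic.exists_measure_lt_eq_min (hμ : Nonatomic μ) :
    ∃ σ : α → ℝ≥0∞, Measurable σ ∧ ∀ t, μ {x | σ x < t} = min t (μ univ) := by
  obtain ⟨M, hM⟩ := exists_isMeasureChain μ
  obtain ⟨D, hD_countable, hD_dense⟩ := TopologicalSpace.exists_countable_dense ℝ≥0∞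
  let ι := {c : ℝ≥0∞ // c ∈ D ∧ c < μ univ}
  have : Countable ι := (hD_countable.mono fun _ h => h.1).to_subtype
  choose E hEM hE using fun c : ι => hM.exists_measure_eq hμ c.2.2
  refine ⟨chainLevel μ E, measurable_chainLevel fun c => hM.measurableSet _ (hEM c), fun t => ?_⟩
  have hdir : DirectedOn (Function.onFun (· ⊆ ·) E) {c | μ (E c) < t} := by
    intro c hc d hd
    rcases le_total (μ (E c)) (μ (E d)) with h | h
    · exact ⟨d, hd, hM.subset_of_measure_le (hEM c) (hEM d) h, Subset.rfl⟩
    · exact ⟨c, hc, Subset.rfl, hM.subset_of_measure_le (hEM d) (hEM c) h⟩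
  rw [setOf_chainLevel_lt, measure_biUnion_eq_iSup (to_countable _) hdir]
  refine le_antisymm (iSup₂_le fun c hc => le_min hc.le (measure_mono (subset_univ _)))
    (le_of_forall_lt fun a ha => ?_)
  obtain ⟨c, hcD, hac, hc⟩ := hD_dense.exists_between ha
  obtain ⟨hct, hc_univ⟩ := lt_min_iff.1 hc
  have hmem : (⟨c, hcD, hc_univ⟩ : ι) ∈ {c | μ (E c) < t} := (hE _).trans_lt hct
  exact hac.trans_le ((hE ⟨c, hcD, hc_univ⟩).ge.trans (le_iSup₂ (f := fun c _ => μ (E c)) _ hmem))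

end MeasureChain

section HalfLine

variable {α : Type*} [MeasurableSpace α] {μ : Measure α}

theorem volume_pos_ofReal_lt (d : ℝ≥0∞) : volume {v : ℝ | 0 < v ∧ ENNReal.ofReal v < d} = d := by
  rcases eq_or_ne d ∞ with rfl | hd
  · have : {v : ℝ | 0 < v ∧ ENNReal.ofReal v < ∞} = Ioi 0 := by
      ext
      simp
    rw [this, Real.volume_Ioi]
  · have : {v : ℝ | 0 < v ∧ ENNReal.ofReal v < d} = Ioo 0 d.toReal := by
      ext v
      exact and_congr_right fun h => ENNReal.ofReal_lt_iff_lt_toReal h.le hd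
    rw [this, Real.volume_Ioo, sub_zero, ENNReal.ofReal_toReal hd]

theorem volume_Ioo_inter_ofReal_lt (t : ℝ) (d : ℝ≥0∞) :
    volume (Ioo 0 t ∩ {v | ENNReal.ofReal v < d}) = min (ENNReal.ofReal t) d := by
  have : Ioo 0 t ∩ {v | ENNReal.ofReal v < d} =
      {v : ℝ | 0 < v ∧ ENNReal.ofReal v < min (ENNReal.ofReal t) d} := by
    ext v
    simp only [mem_inter_iff, mem_Ioo, mem_ofPred_eq, lt_min_iff, and_assoc]
    exact and_congr_right fun hv =>
      and_congr_left' (ENNReal.ofReal_lt_ofReal_iff_of_nonneg hv.le).symm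
  rw [this, volume_pos_ofReal_lt]

theorem halfLine_univ (μ : Measure α) : halfLine μ univ = μ univ := by
  rw [halfLine, Measure.restrict_apply_univ, volume_pos_ofReal_lt]

theorem halfLine_halfLine (μ : Measure α) : halfLine (halfLine μ) = halfLine μ := by
  rw [halfLine, halfLine_univ, halfLine]

theorem halfLine_Iio (μ : Measure α) (t : ℝ) :
    halfLine μ (Iio t) = min (ENNReal.ofReal t) (μ univ) := by
  rw [halfLine, Measure.restrict_apply measurableSet_Iio, ← volume_Ioo_inter_ofReal_lt]
  congr 1
  ext s
  simp only [mem_inter_iff, mem_Iio, mem_ofPred_eq, mem_Ioo]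
  tauto

theorem halfLine_Iic_zero (μ : Measure α) : halfLine μ (Iic 0) = 0 := by
  rw [halfLine, Measure.restrict_apply measurableSet_Iic]
  convert measure_empty (μ := (volume : Measure ℝ))
  exact eq_empty_of_forall_notMem fun t ht => ht.2.1.not_ge ht.1

end HalfLine

/-! ### Rearrangements -/

section Rearrangement

variable {α β : Type*} [MeasurableSpace α] [MeasurableSpace β] {μ : Measure α} {ν : Measure β}
  {f g : α → ℝ≥0∞} {t : ℝ} {l : ℝ≥0∞}

theorem measure_lt_le_of_rearr_le (h : rearr μ f t ≤ l) :
    μ {x | l < f x} ≤ ENNReal.ofReal t := by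
  rcases eq_or_ne l ∞ with rfl | hl
  · simp
  obtain ⟨u, hu_anti, hlu, hu_lim⟩ := exists_seq_strictAnti_tendsto' hl.lt_top
  have hunion : {x | l < f x} = ⋃ n, {x | u n < f x} := by
    ext x
    simp only [mem_ofPred_eq, mem_iUnion]
    exact ⟨fun hx => (hu_lim.eventually (gt_mem_nhds hx)).exists,
      fun ⟨n, hn⟩ => (hlu n).1.trans hn⟩
  have hmono : Monotone fun n => {x | u n < f x} := fun m n hmn x hx =>
    (hu_anti.antitone hmn).trans_lt hx
  rw [hunion, hmono.measure_iUnion]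
  refine iSup_le fun n => ?_
  obtain ⟨m, hm, hmn⟩ := sInf_lt_iff.1 (h.trans_lt (hlu n).1)
  exact (measure_mono fun x hx => hmn.trans hx).trans hm

theorem rearr_le_iff : rearr μ f t ≤ l ↔ μ {x | l < f x} ≤ ENNReal.ofReal t :=
  ⟨measure_lt_le_of_rearr_le, fun h => sInf_le h⟩

theorem lt_rearr_iff : l < rearr μ f t ↔ ENNReal.ofReal t < μ {x | l < f x} := by
  rw [← not_le, rearr_le_iff, not_le]

theorem rearr_antitone (f : α → ℝ≥0∞) : Antitone (rearr μ f) := fun _ _ hst =>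
  rearr_le_iff.2 ((rearr_le_iff.1 le_rfl).trans (ENNReal.ofReal_le_ofReal hst))

theorem measurable_rearr (f : α → ℝ≥0∞) : Measurable (rearr μ f) := (rearr_antitone f).measurable

theorem rearr_mono_ae (h : f ≤ᵐ[μ] g) (t : ℝ) : rearr μ f t ≤ rearr μ g t :=
  rearr_le_iff.2 ((measure_mono_ae (h.mono fun _ hx hl => lt_of_lt_of_le hl hx)).trans
    (rearr_le_iff.1 le_rfl))

theorem rearr_congr_measure {g : β → ℝ≥0∞} (h : ∀ l, μ {x | l < f x} = ν {y | l < g y}) (t : ℝ) :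
    rearr μ f t = rearr ν g t := by
  simp only [rearr, h]

theorem rearr_rearr (f : α → ℝ≥0∞) (t : ℝ) :
    rearr (halfLine μ) (rearr μ f) t = rearr μ f t := by
  refine rearr_congr_measure (fun l => ?_) t
  simp only [lt_rearr_iff]
  rw [halfLine, Measure.restrict_apply (measurableSet_lt ENNReal.measurable_ofReal
    measurable_const), ← volume_pos_ofReal_lt (μ {x | l < f x})]
  congr 1
  ext v
  simp only [mem_inter_iff, mem_ofPred_eq, volume_pos_ofReal_lt]
  exact ⟨fun h => ⟨h.2.1, h.1⟩, fun h => ⟨h.2, h.1, h.2.trans_le (measure_mono (subset_univ _))⟩⟩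

theorem rearr_rearr_halfLine (f : ℝ → ℝ≥0∞) (t : ℝ) :
    rearr (halfLine μ) (rearr (halfLine μ) f) t = rearr (halfLine μ) f t := by
  simpa only [halfLine_halfLine] using rearr_rearr (μ := halfLine μ) f t

theorem rearr_eq_zero_of_measure_univ_le (f : α → ℝ≥0∞) (h : μ univ ≤ ENNReal.ofReal t) :
    rearr μ f t = 0 :=
  nonpos_iff_eq_zero.1 (rearr_le_iff.2 ((measure_mono (subset_univ _)).trans h))

theorem lintegral_eq_lintegral_measure_lt [SFinite μ] (hf : Measurable f) :
    ∫⁻ x, f x ∂μ = ∫⁻ l in Ioi (0 : ℝ), μ {x | ENNReal.ofReal l < f x} := by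
  let hypograph : Set (α × ℝ) := {p | ENNReal.ofReal p.2 < f p.1}
  have hmeas : MeasurableSet hypograph :=
    measurableSet_lt (ENNReal.measurable_ofReal.comp measurable_snd) (hf.comp measurable_fst)
  have hslice (x : α) : f x = volume.restrict (Ioi 0) (Prod.mk x ⁻¹' hypograph) := by
    rw [Measure.restrict_apply (measurable_prodMk_left hmeas), inter_comm]
    exact (volume_pos_ofReal_lt (f x)).symm
  calc ∫⁻ x, f x ∂μ = μ.prod (volume.restrict (Ioi 0)) hypograph := by
        rw [Measure.prod_apply hmeas]
        exact lintegral_congr hslice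
    _ = ∫⁻ l in Ioi (0 : ℝ), μ {x | ENNReal.ofReal l < f x} := Measure.prod_apply_symm hmeas

theorem setLIntegral_le_lintegral_rearr (hf : Measurable f) {E : Set α} {s : ℝ}
    (hE : μ E ≤ ENNReal.ofReal s) : ∫⁻ x in E, f x ∂μ ≤ ∫⁻ v in Ioo 0 s, rearr μ f v := by
  have : IsFiniteMeasure (μ.restrict E) := ⟨by
    rw [Measure.restrict_apply_univ]
    exact hE.trans_lt ENNReal.ofReal_lt_top⟩
  rw [lintegral_eq_lintegral_measure_lt hf, lintegral_eq_lintegral_measure_lt (measurable_rearr f)]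
  refine lintegral_mono fun l => ?_
  simp only [lt_rearr_iff]
  rw [Measure.restrict_apply (measurableSet_lt measurable_const hf), Measure.restrict_apply
    (measurableSet_lt ENNReal.measurable_ofReal measurable_const), inter_comm _ (Ioo 0 s),
    volume_Ioo_inter_ofReal_lt]
  exact le_min ((measure_mono inter_subset_right).trans hE) (measure_mono inter_subset_left)

end Rearrangement

section LengthMap

variable {α : Type*} [MeasurableSpace α] {μ : Measure α}

/-- A map `toFun` that carries `μ`, restricted to the set `carrier`, to Lebesgue measure on
`(0, μ(α))`. If `μ(α) = ∞` the complement of `carrier` may have positive measure. -/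
structure LengthMap (μ : Measure α) where
  carrier : Set α
  toFun : α → ℝ
  measurableSet_carrier : MeasurableSet carrier
  measurable_toFun : Measurable toFun
  map_restrict_eq : (μ.restrict carrier).map toFun = halfLine μ

theorem Nonatomic.nonempty_lengthMap (hμ : Nonatomic μ) : Nonempty (LengthMap μ) := by
  obtain ⟨σ, hσ, hσ_lt⟩ := hμ.exists_measure_lt_eq_min
  have hcarrier : MeasurableSet {x | σ x ≠ ∞} := hσ (measurableSet_singleton ∞).compl
  refine ⟨⟨{x | σ x ≠ ∞}, fun x => (σ x).toReal, hcarrier, hσ.ennreal_toReal, ?_⟩⟩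
  have hIio (t : ℝ) :
      (μ.restrict {x | σ x ≠ ∞}).map (fun x => (σ x).toReal) (Iio t) = halfLine μ (Iio t) := by
    have : (fun x => (σ x).toReal) ⁻¹' Iio t ∩ {x | σ x ≠ ∞} = {x | σ x < ENNReal.ofReal t} := by
      ext x
      constructor
      · exact fun h => (ENNReal.lt_ofReal_iff_toReal_lt h.2).2 h.1
      · exact fun h => ⟨(ENNReal.lt_ofReal_iff_toReal_lt h.ne_top).1 h, h.ne_top⟩
    rw [Measure.map_apply hσ.ennreal_toReal measurableSet_Iio,
      Measure.restrict_apply' hcarrier, this, hσ_lt, halfLine_Iio]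
  refine Measure.ext_of_generateFrom_of_iUnion (⋃ a : ℚ, {Iio (a : ℝ)}) (fun n : ℕ => Iio (n : ℝ))
    (BorelSpace.measurable_eq.trans Real.borel_eq_generateFrom_Iio_rat) Real.isPiSystem_Iio_rat
    (iUnion_eq_univ_iff.2 exists_nat_gt) (fun n => mem_iUnion.2 ⟨n, by simp⟩) (fun n => ?_) ?_
  · rw [hIio, halfLine_Iio]
    exact ((min_le_left _ _).trans_lt ENNReal.ofReal_lt_top).ne
  · intro s hs
    obtain ⟨a, rfl⟩ := mem_iUnion.1 hs
    exact hIio a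

namespace LengthMap

variable (L : LengthMap μ) {h : ℝ → ℝ≥0∞}

/-- The pull-back to `α` of a function on `(0, μ(α))`, extended by zero outside the carrier. -/
def pull (h : ℝ → ℝ≥0∞) : α → ℝ≥0∞ := L.carrier.indicator (h ∘ L.toFun)

theorem measurable_pull (hh : Measurable h) : Measurable (L.pull h) :=
  (hh.comp L.measurable_toFun).indicator L.measurableSet_carrier

theorem measure_preimage_inter {s : Set ℝ} (hs : MeasurableSet s) :
    μ (L.toFun ⁻¹' s ∩ L.carrier) = halfLine μ s := by
  rw [← L.map_restrict_eq, Measure.map_apply L.measurable_toFun hs,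
    Measure.restrict_apply' L.measurableSet_carrier]

theorem measure_lt_pull (hh : Measurable h) (l : ℝ≥0∞) :
    μ {x | l < L.pull h x} = halfLine μ {t | l < h t} := by
  rw [← L.measure_preimage_inter (measurableSet_lt measurable_const hh)]
  congr 1
  ext x
  by_cases hx : x ∈ L.carrier <;> simp [pull, hx]

theorem rearr_pull (hh : Measurable h) (t : ℝ) :
    rearr μ (L.pull h) t = rearr (halfLine μ) h t :=
  rearr_congr_measure (L.measure_lt_pull hh) t

theorem ae_toFun_pos : ∀ᵐ x ∂μ, x ∈ L.carrier → 0 < L.toFun x := by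
  have hnull := (L.measure_preimage_inter measurableSet_Iic).trans (halfLine_Iic_zero μ)
  filter_upwards [measure_eq_zero_iff_ae_notMem.1 hnull] with x hx hxL
  exact not_le.1 fun h => hx ⟨h, hxL⟩

/-- The part of the carrier that is mapped to `(-∞, s)`, up to a null set to `(0, s)`; the sets
`L.initial s` replace the intervals `(0, s)` in averages over `α`. -/
def initial (s : ℝ) : Set α := L.toFun ⁻¹' Iio s ∩ L.carrier

theorem measure_initial_le (s : ℝ) : μ (L.initial s) ≤ ENNReal.ofReal s := by
  rw [initial, L.measure_preimage_inter measurableSet_Iio, halfLine_Iio]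
  exact min_le_left _ _

theorem setLIntegral_initial_pull (hh : Measurable h) (s : ℝ) :
    ∫⁻ x in L.initial s, L.pull h x ∂μ = ∫⁻ t in Iio s, h t ∂halfLine μ := by
  have hmeas := L.measurable_toFun (measurableSet_Iio (a := s))
  rw [← L.map_restrict_eq, setLIntegral_map measurableSet_Iio hh L.measurable_toFun,
    Measure.restrict_restrict hmeas, initial]
  refine setLIntegral_congr_fun (hmeas.inter L.measurableSet_carrier) fun x hx => ?_
  simp [pull, hx.2]

end LengthMap

end LengthMap

/-! ### The representation norm -/

namespace RINorm

variable {α : Type*} [MeasurableSpace α] {μ : Measure α} (ρ : RINorm μ)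
  {h k : ℝ → ℝ≥0∞} {f g : α → ℝ≥0∞}

theorem congr_ae (hf : Measurable f) (hg : Measurable g) (hfg : f =ᵐ[μ] g) :
    ρ.toFun f = ρ.toFun g :=
  le_antisymm (ρ.mono f g hf hg hfg.le) (ρ.mono g f hg hf hfg.symm.le)

theorem repr_eq_of_rearr_eq (hg : Measurable g)
    (hgh : ∀ t : ℝ, 0 < t → rearr μ g t = rearr (halfLine μ) h t) : ρ.repr h = ρ.toFun g := by
  refine le_antisymm (iInf₂_le_of_le g hg (iInf_le _ hgh)) ?_
  refine le_iInf fun g' => le_iInf fun hg' => le_iInf fun hgh' => ?_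
  exact (ρ.rearr_eq g g' hg hg' fun t ht => (hgh t ht).trans (hgh' t ht).symm).le

theorem repr_rearr (hf : Measurable f) : ρ.repr (rearr μ f) = ρ.toFun f :=
  ρ.repr_eq_of_rearr_eq hf fun t _ => (rearr_rearr f t).symm

theorem repr_rearrAbs (f : α →ₘ[μ] ℝ) : ρ.repr (rearrAbs f) = ρ.norm f :=
  ρ.repr_rearr f.measurable.enorm

theorem repr_eq_pull (L : LengthMap μ) (hh : Measurable h) : ρ.repr h = ρ.toFun (L.pull h) :=
  ρ.repr_eq_of_rearr_eq (L.measurable_pull hh) fun t _ => L.rearr_pull hh t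

theorem repr_mono (hμ : Nonatomic μ) (hh : Measurable h) (hk : Measurable k)
    (hhk : ∀ t, 0 < t → h t ≤ k t) : ρ.repr h ≤ ρ.repr k := by
  obtain ⟨L⟩ := hμ.nonempty_lengthMap
  rw [ρ.repr_eq_pull L hh, ρ.repr_eq_pull L hk]
  refine ρ.mono _ _ (L.measurable_pull hh) (L.measurable_pull hk) ?_
  filter_upwards [L.ae_toFun_pos] with x hx
  exact indicator_le_indicator' fun hxL => hhk _ (hx hxL)

theorem repr_add_le (hμ : Nonatomic μ) (hh : Measurable h) (hk : Measurable k) :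
    ρ.repr (h + k) ≤ ρ.repr h + ρ.repr k := by
  obtain ⟨L⟩ := hμ.nonempty_lengthMap
  have hpull : L.pull (h + k) = fun x => L.pull h x + L.pull k x := indicator_add _ _ _
  rw [ρ.repr_eq_pull L hh, ρ.repr_eq_pull L hk, ρ.repr_eq_pull L (hh.add hk), hpull]
  exact ρ.add_le _ _ (L.measurable_pull hh) (L.measurable_pull hk)

theorem repr_const_mul (hμ : Nonatomic μ) (c : ℝ≥0) (hh : Measurable h) :
    ρ.repr (fun t => c * h t) = c * ρ.repr h := by
  obtain ⟨L⟩ := hμ.nonempty_lengthMap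
  have hpull : L.pull (fun t => c * h t) = fun x => c * L.pull h x :=
    funext (indicator_const_mul _ _ _)
  rw [ρ.repr_eq_pull L hh, ρ.repr_eq_pull L (hh.const_mul _), hpull,
    ρ.smul c _ (L.measurable_pull hh)]

theorem ae_lt_top (hμ : Nonatomic μ) (hf : Measurable f) (hρf : ρ.toFun f < ∞) :
    ∀ᵐ x ∂μ, f x < ∞ := by
  have hmeas : MeasurableSet {x | f x = ∞} := hf (measurableSet_singleton ∞)
  by_contra hcon
  have hpos : 0 < μ {x | f x = ∞} := pos_iff_ne_zero.2 (by simpa [ae_iff] using hcon)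
  obtain ⟨F, hF, hF_sub, hF_pos, hF_lt⟩ := hμ _ hmeas hpos
  obtain ⟨C, hC⟩ := ρ.lintegral_le F hF hF_lt.lt_top
  have hfin : ∫⁻ x in F, f x ∂μ ≠ ∞ :=
    ((hC f hf).trans_lt (ENNReal.mul_lt_top ENNReal.coe_lt_top hρf)).ne
  refine hfin (top_unique ?_)
  calc ∞ = ∫⁻ _ in F, ∞ ∂μ := by rw [setLIntegral_const, ENNReal.top_mul hF_pos.ne']
    _ ≤ ∫⁻ x in F, f x ∂μ := setLIntegral_mono hf fun x hx => (hF_sub hx).ge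

theorem exists_enorm_ae_eq (hμ : Nonatomic μ) (hf : Measurable f) (hρf : ρ.toFun f < ∞) :
    ∃ g : α →ₘ[μ] ℝ, (fun x => ‖g x‖ₑ) =ᵐ[μ] f := by
  have hmeas := hf.ennreal_toReal.aestronglyMeasurable (μ := μ)
  refine ⟨AEEqFun.mk (fun x => (f x).toReal) hmeas, ?_⟩
  filter_upwards [ρ.ae_lt_top hμ hf hρf, AEEqFun.coeFn_mk _ hmeas] with x hx hx'
  rw [hx', Real.enorm_of_nonneg ENNReal.toReal_nonneg, ENNReal.ofReal_toReal hx.ne]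

end RINorm

/-! ### Hardy's inequality -/

section Hardy

variable {φ : ℝ → ℝ≥0∞} {a b p q s u : ℝ}

theorem ofReal_rpow_mul_rpow (hs : 0 < s) (a b : ℝ) :
    ENNReal.ofReal (s ^ a) * ENNReal.ofReal (s ^ b) = ENNReal.ofReal (s ^ (a + b)) := by
  rw [← ENNReal.ofReal_mul (by positivity), Real.rpow_add hs]

theorem ofReal_rpow_rpow (hs : 0 < s) (a b : ℝ) :
    ENNReal.ofReal (s ^ a) ^ b = ENNReal.ofReal (s ^ (a * b)) := by
  rw [ENNReal.ofReal_rpow_of_pos (by positivity), Real.rpow_mul hs.le]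

@[fun_prop]
theorem measurable_ofReal_rpow (a : ℝ) : Measurable fun s : ℝ => ENNReal.ofReal (s ^ a) :=
  ENNReal.measurable_ofReal.comp (measurable_id.pow_const a)

theorem one_sub_one_div_pos (hp : 1 < p) : 0 < 1 - 1 / p := by
  rw [one_div]
  exact sub_pos.2 (inv_lt_one_of_one_lt₀ hp)

theorem lintegral_Ioo_rpow (ha : 0 < a) (hu : 0 ≤ u) :
    ∫⁻ s in Ioo 0 u, ENNReal.ofReal (s ^ (a - 1)) = ENNReal.ofReal (u ^ a / a) := by
  have h_int : IntegrableOn (fun s : ℝ => s ^ (a - 1)) (Ioo 0 u) :=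
    ((intervalIntegrable_iff_integrableOn_Ioc_of_le hu).1
      (intervalIntegral.intervalIntegrable_rpow' (by linarith))).mono_set Ioo_subset_Ioc_self
  have hnonneg : ∀ᵐ s ∂volume.restrict (Ioo 0 u), 0 ≤ s ^ (a - 1) := by
    filter_upwards [ae_restrict_mem measurableSet_Ioo] with s hs
    exact Real.rpow_nonneg hs.1.le _
  rw [← ofReal_integral_eq_lintegral_ofReal h_int hnonneg, ← integral_Ioc_eq_integral_Ioo,
    ← intervalIntegral.integral_of_le hu, integral_rpow (Or.inl (by linarith)), sub_add_cancel,
    Real.zero_rpow ha.ne', sub_zero]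

theorem lintegral_Ioi_rpow (ha : 0 < a) (hu : 0 < u) :
    ∫⁻ s in Ioi u, ENNReal.ofReal (s ^ (-a - 1)) = ENNReal.ofReal (u ^ (-a) / a) := by
  have hnonneg : ∀ᵐ s ∂volume.restrict (Ioi u), 0 ≤ s ^ (-a - 1) := by
    filter_upwards [ae_restrict_mem measurableSet_Ioi] with s hs
    exact Real.rpow_nonneg (hu.trans hs).le _
  rw [← ofReal_integral_eq_lintegral_ofReal (integrableOn_Ioi_rpow_of_lt (by linarith) hu)
    hnonneg, integral_Ioi_rpow_of_lt (by linarith) hu, sub_add_cancel, neg_div_neg_eq]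

/-- The average of `φ` over `(0, s)`, the operator of Hardy's inequality. -/
def mean (φ : ℝ → ℝ≥0∞) (s : ℝ) : ℝ≥0∞ := ENNReal.ofReal (s ^ (-1 : ℝ)) * ∫⁻ v in Ioo 0 s, φ v

theorem lintegral_Ioi_mul_lintegral_Ioo {K ψ : ℝ → ℝ≥0∞} (hK : Measurable K)
    (hψ : Measurable ψ) :
    ∫⁻ s in Ioi (0 : ℝ), K s * ∫⁻ v in Ioo 0 s, ψ v =
      ∫⁻ v in Ioi (0 : ℝ), ψ v * ∫⁻ s in Ioi v, K s := by
  let F : ℝ × ℝ → ℝ≥0∞ := {p : ℝ × ℝ | p.2 < p.1}.indicator fun p => K p.1 * ψ p.2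
  have hF : Measurable F :=
    ((hK.comp measurable_fst).mul (hψ.comp measurable_snd)).indicator
      (measurableSet_lt measurable_snd measurable_fst)
  have hleft (s : ℝ) : K s * ∫⁻ v in Ioo 0 s, ψ v = ∫⁻ v in Ioi (0 : ℝ), F (s, v) := by
    have hslice : (fun v => F (s, v)) = (Iio s).indicator fun v => K s * ψ v := rfl
    rw [hslice, lintegral_indicator measurableSet_Iio, Measure.restrict_restrict measurableSet_Iio,
      Iio_inter_Ioi, lintegral_const_mul _ hψ]
  have hright : ∀ v ∈ Ioi (0 : ℝ), ψ v * ∫⁻ s in Ioi v, K s = ∫⁻ s in Ioi (0 : ℝ), F (s, v) := by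
    intro v hv
    have hslice : (fun s => F (s, v)) = (Ioi v).indicator fun s => ψ v * K s := by
      ext s
      simp only [F, indicator, mem_ofPred_eq, mem_Ioi, mul_comm]
    rw [hslice, lintegral_indicator measurableSet_Ioi, Measure.restrict_restrict measurableSet_Ioi,
      inter_eq_left.2 (Ioi_subset_Ioi (le_of_lt hv)), lintegral_const_mul _ hK]
  rw [lintegral_congr hleft, setLIntegral_congr_fun measurableSet_Ioi hright]
  exact lintegral_lintegral_swap hF.aemeasurable

theorem lintegral_Ioo_rpow_le (hφ : Measurable φ) (hp : 1 < p) (hq : 1 ≤ q) (hs : 0 < s) :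
    (∫⁻ v in Ioo 0 s, φ v) ^ q ≤ ENNReal.ofReal (s ^ (1 - 1 / p) / (1 - 1 / p)) ^ (q - 1) *
      ∫⁻ v in Ioo 0 s, ENNReal.ofReal (v ^ ((q - 1) / p)) * φ v ^ q := by
  have hq_pos : 0 < q := by linarith
  have hp_ne : p ≠ 0 := by linarith
  have hholder := ENNReal.lintegral_mul_norm_pow_le (μ := volume.restrict (Ioo 0 s))
    (f := fun v => ENNReal.ofReal (v ^ ((q - 1) / p)) * φ v ^ q)
    (g := fun v => ENNReal.ofReal (v ^ (1 - 1 / p - 1)))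
    (by fun_prop) (by fun_prop) (p := 1 / q) (q := 1 - 1 / q) (by positivity)
    (by rw [sub_nonneg, div_le_one hq_pos]; exact hq) (by ring)
  have hfactor : ∫⁻ v in Ioo 0 s, (ENNReal.ofReal (v ^ ((q - 1) / p)) * φ v ^ q) ^ (1 / q) *
      ENNReal.ofReal (v ^ (1 - 1 / p - 1)) ^ (1 - 1 / q) = ∫⁻ v in Ioo 0 s, φ v := by
    refine setLIntegral_congr_fun measurableSet_Ioo fun v hv => ?_
    have hexp : (q - 1) / p * (1 / q) + (1 - 1 / p - 1) * (1 - 1 / q) = 0 := by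
      field_simp
      ring
    rw [ENNReal.mul_rpow_of_nonneg _ _ (by positivity), ← ENNReal.rpow_mul,
      mul_one_div_cancel hq_pos.ne', ENNReal.rpow_one, ofReal_rpow_rpow hv.1, ofReal_rpow_rpow hv.1,
      mul_right_comm, ofReal_rpow_mul_rpow hv.1, hexp, Real.rpow_zero, ENNReal.ofReal_one, one_mul]
  rw [hfactor, lintegral_Ioo_rpow (one_sub_one_div_pos hp) hs.le] at hholder
  refine (ENNReal.rpow_le_rpow hholder hq_pos.le).trans_eq ?_
  rw [ENNReal.mul_rpow_of_nonneg _ _ hq_pos.le, ← ENNReal.rpow_mul, ← ENNReal.rpow_mul,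
    one_div_mul_cancel hq_pos.ne', ENNReal.rpow_one, mul_comm, sub_mul,
    one_div_mul_cancel hq_pos.ne', one_mul]

theorem rpow_mul_mean_rpow_le (hφ : Measurable φ) (hp : 1 < p) (hq : 1 ≤ q) (hs : 0 < s) :
    ENNReal.ofReal (s ^ (q / p - 1)) * mean φ s ^ q ≤
      ENNReal.ofReal (1 / (1 - 1 / p)) ^ (q - 1) * (ENNReal.ofReal (s ^ (-(1 - 1 / p) - 1)) *
        ∫⁻ v in Ioo 0 s, ENNReal.ofReal (v ^ ((q - 1) / p)) * φ v ^ q) := by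
  have hq_nonneg : 0 ≤ q := by linarith
  have hexp : -(1 - 1 / p) - 1 = q / p - 1 + -1 * q + (1 - 1 / p) * (q - 1) := by ring
  rw [mean, ENNReal.mul_rpow_of_nonneg _ _ hq_nonneg, ofReal_rpow_rpow hs, ← mul_assoc,
    ofReal_rpow_mul_rpow hs]
  refine (mul_le_mul_right (lintegral_Ioo_rpow_le hφ hp hq hs) _).trans_eq ?_
  rw [div_eq_mul_one_div (s ^ (1 - 1 / p)), ENNReal.ofReal_mul (by positivity),
    ENNReal.mul_rpow_of_nonneg _ _ (by linarith), ofReal_rpow_rpow hs, hexp,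
    ← ofReal_rpow_mul_rpow hs (q / p - 1 + -1 * q)]
  ring

theorem lintegral_rpow_mul_mean_rpow_le (hφ : Measurable φ) (hp : 1 < p) (hq : 1 ≤ q) :
    ∫⁻ s in Ioi (0 : ℝ), ENNReal.ofReal (s ^ (q / p - 1)) * mean φ s ^ q ≤
      ENNReal.ofReal (1 / (1 - 1 / p)) ^ q *
        ∫⁻ s in Ioi (0 : ℝ), ENNReal.ofReal (s ^ (q / p - 1)) * φ s ^ q := by
  have ha := one_sub_one_div_pos hp
  set c := ENNReal.ofReal (1 / (1 - 1 / p)) with hc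
  have hc_pow : c ^ (q - 1) ≠ ∞ :=
    ENNReal.rpow_ne_top_of_nonneg (by linarith) ENNReal.ofReal_ne_top
  calc ∫⁻ s in Ioi (0 : ℝ), ENNReal.ofReal (s ^ (q / p - 1)) * mean φ s ^ q
      ≤ ∫⁻ s in Ioi (0 : ℝ), c ^ (q - 1) * (ENNReal.ofReal (s ^ (-(1 - 1 / p) - 1)) *
          ∫⁻ v in Ioo 0 s, ENNReal.ofReal (v ^ ((q - 1) / p)) * φ v ^ q) :=
        setLIntegral_mono' measurableSet_Ioi fun s hs => rpow_mul_mean_rpow_le hφ hp hq hs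
    _ = c ^ (q - 1) * ∫⁻ v in Ioi (0 : ℝ), ENNReal.ofReal (v ^ ((q - 1) / p)) * φ v ^ q *
          ∫⁻ s in Ioi v, ENNReal.ofReal (s ^ (-(1 - 1 / p) - 1)) := by
        rw [lintegral_const_mul' _ _ hc_pow,
          lintegral_Ioi_mul_lintegral_Ioo (by fun_prop) (by fun_prop)]
    _ = c ^ (q - 1) * ∫⁻ v in Ioi (0 : ℝ), c * (ENNReal.ofReal (v ^ (q / p - 1)) * φ v ^ q) := by
        congr 1
        refine setLIntegral_congr_fun measurableSet_Ioi fun v (hv : 0 < v) => ?_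
        have hexp : q / p - 1 = (q - 1) / p + -(1 - 1 / p) := by ring
        rw [lintegral_Ioi_rpow ha hv, div_eq_mul_one_div (v ^ _),
          ENNReal.ofReal_mul (by positivity), ← hc, hexp, ← ofReal_rpow_mul_rpow hv]
        ring
    _ = c ^ q * ∫⁻ v in Ioi (0 : ℝ), ENNReal.ofReal (v ^ (q / p - 1)) * φ v ^ q := by
        have hc_ne : c ≠ 0 := (ENNReal.ofReal_pos.2 (one_div_pos.2 ha)).ne'
        rw [lintegral_const_mul' _ _ ENNReal.ofReal_ne_top, ← mul_assoc,
          ENNReal.rpow_sub _ _ hc_ne ENNReal.ofReal_ne_top, ENNReal.rpow_one,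
          ENNReal.div_mul_cancel hc_ne ENNReal.ofReal_ne_top]

theorem rpow_mul_le_lintegral_of_antitone (hφ : Antitone φ) (hp : 0 < p) (hq : 0 < q)
    (hs : 0 < s) :
    ENNReal.ofReal (s ^ (1 / p)) * φ s ≤ ENNReal.ofReal ((q / p) ^ (1 / q)) *
      (∫⁻ t in Ioo 0 s, ENNReal.ofReal (t ^ (q / p - 1)) * φ t ^ q) ^ (1 / q) := by
  have hqp : 0 < q / p := by positivity
  have hle : ENNReal.ofReal (s ^ (q / p) / (q / p)) * φ s ^ q ≤
      ∫⁻ t in Ioo 0 s, ENNReal.ofReal (t ^ (q / p - 1)) * φ t ^ q := by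
    rw [← lintegral_Ioo_rpow hqp hs.le, ← lintegral_mul_const _ (by fun_prop)]
    refine setLIntegral_mono' measurableSet_Ioo fun t ht => ?_
    gcongr
    exact hφ ht.2.le
  refine le_trans (le_of_eq ?_)
    (mul_le_mul_right (ENNReal.rpow_le_rpow hle (one_div_nonneg.2 hq.le)) _)
  rw [ENNReal.mul_rpow_of_nonneg _ _ (by positivity), ← ENNReal.rpow_mul,
    mul_one_div_cancel hq.ne', ENNReal.rpow_one, ← mul_assoc,
    ENNReal.ofReal_rpow_of_pos (by positivity), ← ENNReal.ofReal_mul (by positivity),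
    ← Real.mul_rpow (by positivity) (by positivity), mul_div_cancel₀ _ hqp.ne',
    ← Real.rpow_mul hs.le]
  congr 3
  field_simp

theorem mean_le_of_rpow_mul_le (hp : 1 < p) (hs : 0 < s) {N : ℝ≥0∞}
    (h : ∀ v, 0 < v → ENNReal.ofReal (v ^ (1 / p)) * φ v ≤ N) :
    mean φ s ≤ ENNReal.ofReal (1 / (1 - 1 / p)) * ENNReal.ofReal (s ^ (-(1 / p))) * N := by
  have ha := one_sub_one_div_pos hp
  have h_int : ∫⁻ v in Ioo 0 s, φ v ≤ ENNReal.ofReal (s ^ (1 - 1 / p) / (1 - 1 / p)) * N := by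
    rw [← lintegral_Ioo_rpow ha hs.le, ← lintegral_mul_const _ (by fun_prop)]
    refine setLIntegral_mono' measurableSet_Ioo fun v hv => ?_
    refine le_trans (le_of_eq ?_) (mul_le_mul_right (h v hv.1) _)
    rw [← mul_assoc, ofReal_rpow_mul_rpow hv.1, sub_sub_cancel_left, neg_add_cancel,
      Real.rpow_zero, ENNReal.ofReal_one, one_mul]
  refine (mul_le_mul_right h_int _).trans_eq ?_
  rw [div_eq_mul_one_div (s ^ _), ENNReal.ofReal_mul (by positivity), ← mul_assoc, ← mul_assoc,
    ofReal_rpow_mul_rpow hs, mul_comm (ENNReal.ofReal (1 / (1 - 1 / p)))]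
  congr 4
  ring

theorem mean_le_lintegral_rpow (hφ : Measurable φ) (hq : 1 ≤ q) (hs : 0 < s) :
    mean φ s ≤ ENNReal.ofReal (s ^ (-(1 / q))) *
      ∫⁻ v in Ioi (0 : ℝ), ENNReal.ofReal (v ^ (1 / q - 1)) * φ v := by
  have hexp : 1 / q - 1 ≤ 0 := by
    rw [sub_nonpos, div_le_one (by linarith)]
    exact hq
  have h_int : ENNReal.ofReal (s ^ (1 / q - 1)) * ∫⁻ v in Ioo 0 s, φ v ≤
      ∫⁻ v in Ioi (0 : ℝ), ENNReal.ofReal (v ^ (1 / q - 1)) * φ v := by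
    rw [← lintegral_const_mul _ hφ]
    refine (setLIntegral_mono' measurableSet_Ioo fun v hv => ?_).trans
      (lintegral_mono_set Ioo_subset_Ioi_self)
    gcongr ENNReal.ofReal ?_ * _
    exact Real.rpow_le_rpow_of_nonpos hv.1 hv.2.le hexp
  refine le_trans (le_of_eq ?_) (mul_le_mul_right h_int _)
  rw [mean, ← mul_assoc, ofReal_rpow_mul_rpow hs]
  congr 3
  ring

end Hardy

/-! ### The operators `R` and `S` without the rearrangement -/

section HardyOperators

variable {w w' φ : ℝ → ℝ≥0∞} {p₀ q₀ p₁ q t : ℝ}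

theorem slope_mul_sub (hp₀ : p₀ ≠ 0) (hq : q ≠ 0) (hpq : p₀ ≠ q) :
    slope p₀ p₁ q * (1 / p₀ - 1 / q) = 1 / p₁ := by
  have hsub : q - p₀ ≠ 0 := sub_ne_zero.2 hpq.symm
  rw [slope, mul_comm p₁, ← div_div, ← div_mul_eq_mul_div]
  field_simp

/-- The operator `calderonR` with the rearrangement in its definition replaced by an arbitrary
function `w`, so that `calderonR m p₀ q₀ p₁ q f` is `hardyR p₀ q₀ p₁ q (rearr m f)` and the
dependence on `w` is sublinear. -/
def hardyR (p₀ q₀ p₁ q : ℝ) (w : ℝ → ℝ≥0∞) (t : ℝ) : ℝ≥0∞ :=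
  ENNReal.ofReal (t ^ (-(1 / p₁))) *
    (∫⁻ s in Ioo (0 : ℝ) (t ^ slope p₀ p₁ q),
      ENNReal.ofReal (s ^ (q₀ / p₀ - 1)) * w s ^ q₀) ^ (1 / q₀)

/-- The analogue of `hardyR` for `calderonS`, so that `calderonS m p₀ p₁ q f` is
`hardyS p₀ p₁ q (rearr m f)`. -/
def hardyS (p₀ p₁ q : ℝ) (w : ℝ → ℝ≥0∞) (t : ℝ) : ℝ≥0∞ :=
  ∫⁻ s in Ioi (t ^ slope p₀ p₁ q), ENNReal.ofReal (s ^ (1 / q - 1)) * w s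

theorem measurable_hardyR : Measurable (hardyR p₀ q₀ p₁ q w) := by
  have hmono : Monotone fun u : ℝ => ∫⁻ s in Ioo (0 : ℝ) u,
      ENNReal.ofReal (s ^ (q₀ / p₀ - 1)) * w s ^ q₀ := fun u v huv =>
    lintegral_mono_set (Ioo_subset_Ioo_right huv)
  exact (measurable_ofReal_rpow _).mul
    ((hmono.measurable.comp (measurable_id.pow_const _)).pow_const _)

theorem measurable_hardyS : Measurable (hardyS p₀ p₁ q w) := by
  have hanti : Antitone fun u : ℝ => ∫⁻ s in Ioi u, ENNReal.ofReal (s ^ (1 / q - 1)) * w s :=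
    fun u v huv => lintegral_mono_set (Ioi_subset_Ioi huv)
  exact hanti.measurable.comp (measurable_id.pow_const _)

theorem hardyR_mono (hq₀ : 0 ≤ q₀) (h : ∀ s, 0 < s → w s ≤ w' s) (t : ℝ) :
    hardyR p₀ q₀ p₁ q w t ≤ hardyR p₀ q₀ p₁ q w' t := by
  refine mul_le_mul_right (ENNReal.rpow_le_rpow ?_ (by positivity)) _
  refine setLIntegral_mono' measurableSet_Ioo fun s hs => ?_
  gcongr
  exact h s hs.1

theorem hardyS_mono (h : ∀ s, 0 < s → w s ≤ w' s) (ht : 0 < t) :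
    hardyS p₀ p₁ q w t ≤ hardyS p₀ p₁ q w' t := by
  refine setLIntegral_mono' measurableSet_Ioi fun s hs => ?_
  gcongr
  exact h s ((Real.rpow_pos_of_pos ht _).trans hs)

theorem hardyR_const_mul (hq₀ : 0 < q₀) (hw : Measurable w) (c : ℝ≥0∞) (t : ℝ) :
    hardyR p₀ q₀ p₁ q (fun s => c * w s) t = c * hardyR p₀ q₀ p₁ q w t := by
  have hfactor (s : ℝ) : ENNReal.ofReal (s ^ (q₀ / p₀ - 1)) * (c * w s) ^ q₀ =
      c ^ q₀ * (ENNReal.ofReal (s ^ (q₀ / p₀ - 1)) * w s ^ q₀) := by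
    rw [ENNReal.mul_rpow_of_nonneg _ _ hq₀.le, mul_left_comm]
  simp only [hardyR, hfactor]
  rw [lintegral_const_mul _ (by fun_prop), ENNReal.mul_rpow_of_nonneg _ _ (by positivity),
    ← ENNReal.rpow_mul, mul_one_div_cancel hq₀.ne', ENNReal.rpow_one, mul_left_comm]

theorem hardyS_const_mul (hw : Measurable w) (c : ℝ≥0∞) (t : ℝ) :
    hardyS p₀ p₁ q (fun s => c * w s) t = c * hardyS p₀ p₁ q w t := by
  simp only [hardyS, mul_left_comm _ c]
  exact lintegral_const_mul _ (by fun_prop)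

theorem hardyR_add_le (hq₀ : 1 ≤ q₀) (hw : Measurable w) (hw' : Measurable w') (t : ℝ) :
    hardyR p₀ q₀ p₁ q (fun s => w s + w' s) t ≤
      hardyR p₀ q₀ p₁ q w t + hardyR p₀ q₀ p₁ q w' t := by
  have hq₀_pos : 0 < q₀ := by linarith
  have hminkowski := ENNReal.lintegral_Lp_add_le
    (μ := volume.restrict (Ioo (0 : ℝ) (t ^ slope p₀ p₁ q)))
    (f := fun s => ENNReal.ofReal (s ^ (q₀ / p₀ - 1)) ^ (1 / q₀) * w s)
    (g := fun s => ENNReal.ofReal (s ^ (q₀ / p₀ - 1)) ^ (1 / q₀) * w' s)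
    (by fun_prop) (by fun_prop) hq₀
  have hweight (s : ℝ) (x : ℝ≥0∞) :
      (ENNReal.ofReal (s ^ (q₀ / p₀ - 1)) ^ (1 / q₀) * x) ^ q₀ =
        ENNReal.ofReal (s ^ (q₀ / p₀ - 1)) * x ^ q₀ := by
    rw [ENNReal.mul_rpow_of_nonneg _ _ hq₀_pos.le, ← ENNReal.rpow_mul,
      one_div_mul_cancel hq₀_pos.ne', ENNReal.rpow_one]
  simp only [Pi.add_apply, ← mul_add, hweight] at hminkowski
  simp only [hardyR]
  rw [← mul_add]
  gcongr

theorem hardyS_add_le (hw : Measurable w) (t : ℝ) :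
    hardyS p₀ p₁ q (fun s => w s + w' s) t ≤ hardyS p₀ p₁ q w t + hardyS p₀ p₁ q w' t := by
  simp only [hardyS, mul_add]
  exact (lintegral_add_left (by fun_prop) _).le

theorem hardyR_mean_le (hp₀ : 1 < p₀) (hq₀ : 1 ≤ q₀) (hφ : Measurable φ) (t : ℝ) :
    hardyR p₀ q₀ p₁ q (mean φ) t ≤ ENNReal.ofReal (1 / (1 - 1 / p₀)) *
      ENNReal.ofReal (t ^ (-(1 / p₁))) *
      (∫⁻ s in Ioi (0 : ℝ), ENNReal.ofReal (s ^ (q₀ / p₀ - 1)) * φ s ^ q₀) ^ (1 / q₀) := by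
  have hq₀_pos : 0 < q₀ := by linarith
  rw [hardyR, mul_comm (ENNReal.ofReal (1 / (1 - 1 / p₀))), mul_assoc]
  gcongr
  refine (ENNReal.rpow_le_rpow ((lintegral_mono_set Ioo_subset_Ioi_self).trans
    (lintegral_rpow_mul_mean_rpow_le hφ hp₀ hq₀)) (by positivity)).trans_eq ?_
  rw [ENNReal.mul_rpow_of_nonneg _ _ (by positivity), ← ENNReal.rpow_mul,
    mul_one_div_cancel hq₀_pos.ne', ENNReal.rpow_one]

theorem lintegral_Ioo_rpow_mul_mean_rpow_le (hp₀ : 0 < p₀) (hpq : p₀ < q) (hq : 1 ≤ q)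
    (hq₀ : 0 < q₀) (hφ : Measurable φ) {u : ℝ} (hu : 0 < u) :
    ∫⁻ s in Ioo 0 u, ENNReal.ofReal (s ^ (q₀ / p₀ - 1)) * mean φ s ^ q₀ ≤
      ENNReal.ofReal (u ^ (q₀ * (1 / p₀ - 1 / q)) / (q₀ * (1 / p₀ - 1 / q))) *
        (∫⁻ s in Ioi (0 : ℝ), ENNReal.ofReal (s ^ (1 / q - 1)) * φ s) ^ q₀ := by
  have hδ : 0 < 1 / p₀ - 1 / q := sub_pos.2 (one_div_lt_one_div_of_lt hp₀ hpq)
  rw [← lintegral_Ioo_rpow (by positivity) hu.le, ← lintegral_mul_const _ (by fun_prop)]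
  refine setLIntegral_mono' measurableSet_Ioo fun s hs => ?_
  refine (mul_le_mul_right (ENNReal.rpow_le_rpow
    (mean_le_lintegral_rpow hφ hq hs.1) hq₀.le) _).trans_eq ?_
  rw [ENNReal.mul_rpow_of_nonneg _ _ hq₀.le, ← mul_assoc, ofReal_rpow_rpow hs.1,
    ofReal_rpow_mul_rpow hs.1]
  congr 3
  ring

theorem hardyR_mean_le_const (hp₀ : 0 < p₀) (hpq : p₀ < q) (hq : 1 ≤ q) (hq₀ : 0 < q₀)
    (hφ : Measurable φ) (ht : 0 < t) :
    hardyR p₀ q₀ p₁ q (mean φ) t ≤ ENNReal.ofReal ((1 / (q₀ * (1 / p₀ - 1 / q))) ^ (1 / q₀)) *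
      ∫⁻ s in Ioi (0 : ℝ), ENNReal.ofReal (s ^ (1 / q - 1)) * φ s := by
  have hδ : 0 < 1 / p₀ - 1 / q := sub_pos.2 (one_div_lt_one_div_of_lt hp₀ hpq)
  have hu : 0 < t ^ slope p₀ p₁ q := Real.rpow_pos_of_pos ht _
  have hexp : -(1 / p₁) + slope p₀ p₁ q * (q₀ * (1 / p₀ - 1 / q) * (1 / q₀)) = 0 := by
    rw [mul_right_comm, mul_one_div_cancel hq₀.ne', one_mul,
      slope_mul_sub hp₀.ne' (hp₀.trans hpq).ne' hpq.ne, neg_add_cancel]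
  refine (mul_le_mul_right (ENNReal.rpow_le_rpow
    (lintegral_Ioo_rpow_mul_mean_rpow_le hp₀ hpq hq hq₀ hφ hu) (by positivity)) _).trans_eq ?_
  rw [ENNReal.mul_rpow_of_nonneg _ _ (by positivity), ← ENNReal.rpow_mul,
    mul_one_div_cancel hq₀.ne', ENNReal.rpow_one, ← mul_assoc, div_eq_mul_one_div (_ ^ _),
    ENNReal.ofReal_mul (by positivity), ENNReal.mul_rpow_of_nonneg _ _ (by positivity),
    ofReal_rpow_rpow hu, ENNReal.ofReal_rpow_of_pos (by positivity), ← mul_assoc,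
    ← Real.rpow_mul ht.le, ofReal_rpow_mul_rpow ht, hexp, Real.rpow_zero, ENNReal.ofReal_one,
    one_mul]

theorem hardyS_mean_le (hp₀ : 1 < p₀) (hpq : p₀ < q) (ht : 0 < t) {N : ℝ≥0∞}
    (h : ∀ v, 0 < v → ENNReal.ofReal (v ^ (1 / p₀)) * φ v ≤ N) :
    hardyS p₀ p₁ q (mean φ) t ≤ ENNReal.ofReal (1 / (1 / p₀ - 1 / q)) *
      ENNReal.ofReal (1 / (1 - 1 / p₀)) * ENNReal.ofReal (t ^ (-(1 / p₁))) * N := by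
  have hp₀_pos : 0 < p₀ := by linarith
  have hδ : 0 < 1 / p₀ - 1 / q := sub_pos.2 (one_div_lt_one_div_of_lt hp₀_pos hpq)
  have hu : 0 < t ^ slope p₀ p₁ q := Real.rpow_pos_of_pos ht _
  calc hardyS p₀ p₁ q (mean φ) t
      ≤ ∫⁻ s in Ioi (t ^ slope p₀ p₁ q), ENNReal.ofReal (s ^ (-(1 / p₀ - 1 / q) - 1)) *
          (ENNReal.ofReal (1 / (1 - 1 / p₀)) * N) := by
        refine setLIntegral_mono' measurableSet_Ioi fun s hus => ?_
        have hs : 0 < s := hu.trans hus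
        have hexp : -(1 / p₀ - 1 / q) - 1 = (1 / q - 1) + -(1 / p₀) := by ring
        refine (mul_le_mul_right (mean_le_of_rpow_mul_le hp₀ hs h) _).trans_eq ?_
        rw [hexp, ← ofReal_rpow_mul_rpow hs]
        ring
    _ = _ := by
        rw [lintegral_mul_const _ (by fun_prop), lintegral_Ioi_rpow hδ hu,
          div_eq_mul_one_div (_ ^ _), ENNReal.ofReal_mul (by positivity),
          ← Real.rpow_mul ht.le, mul_neg,
          slope_mul_sub hp₀_pos.ne' (hp₀_pos.trans hpq).ne' hpq.ne]
        ring

theorem hardyS_mean_le_const (hq : 1 < q) (hφ : Measurable φ) (ht : 0 < t) :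
    hardyS p₀ p₁ q (mean φ) t ≤ ENNReal.ofReal (1 / (1 - 1 / q)) *
      ∫⁻ s in Ioi (0 : ℝ), ENNReal.ofReal (s ^ (1 / q - 1)) * φ s := by
  have hhardy := lintegral_rpow_mul_mean_rpow_le hφ hq le_rfl
  simp only [ENNReal.rpow_one] at hhardy
  exact (lintegral_mono_set (Ioi_subset_Ioi (Real.rpow_pos_of_pos ht _).le)).trans hhardy

/-- A sublinear functional `Φ` of functions on the half-line whose values at averages of
nonincreasing functions `φ` obey the bounds of `L^{p₀,q₀} → L^{p₁,∞}` and `L^{q,1} → L^∞`. It is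
the common abstraction of `hardyR` and `hardyS` from which operators on `α` are built. -/
structure EndpointFunctional (p₀ q₀ p₁ q : ℝ) (Φ : (ℝ → ℝ≥0∞) → ℝ → ℝ≥0∞) : Prop where
  measurable : ∀ w, Measurable (Φ w)
  mono : ∀ w w', (∀ s, 0 < s → w s ≤ w' s) → ∀ t, 0 < t → Φ w t ≤ Φ w' t
  add_le : ∀ w w', Measurable w → Measurable w' → ∀ t, Φ (fun s => w s + w' s) t ≤ Φ w t + Φ w' t
  const_mul : ∀ (c : ℝ≥0∞) w, Measurable w → ∀ t, Φ (fun s => c * w s) t = c * Φ w t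
  weak_bound : ∃ C : ℝ≥0, ∀ φ : ℝ → ℝ≥0∞, Antitone φ → ∀ t, 0 < t →
    Φ (mean φ) t ≤ C * ENNReal.ofReal (t ^ (-(1 / p₁))) *
      (∫⁻ s in Ioi (0 : ℝ), ENNReal.ofReal (s ^ (q₀ / p₀ - 1)) * φ s ^ q₀) ^ (1 / q₀)
  strong_bound : ∃ C : ℝ≥0, ∀ φ : ℝ → ℝ≥0∞, Antitone φ → ∀ t, 0 < t →
    Φ (mean φ) t ≤ C * ∫⁻ s in Ioi (0 : ℝ), ENNReal.ofReal (s ^ (1 / q - 1)) * φ s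

theorem endpointFunctional_hardyR (hp₀ : 1 < p₀) (hpq : p₀ < q) (hq₀ : 1 ≤ q₀) :
    EndpointFunctional p₀ q₀ p₁ q (hardyR p₀ q₀ p₁ q) where
  measurable _ := measurable_hardyR
  mono _ _ h t _ := hardyR_mono (by linarith) h t
  add_le _ _ hw hw' t := hardyR_add_le hq₀ hw hw' t
  const_mul c _ hw t := hardyR_const_mul (by linarith) hw c t
  weak_bound := ⟨_, fun _ hφ t _ => hardyR_mean_le hp₀ hq₀ hφ.measurable t⟩
  strong_bound := ⟨_, fun _ hφ _ ht => hardyR_mean_le_const (by linarith) hpq (by linarith)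
    (by linarith) hφ.measurable ht⟩

theorem endpointFunctional_hardyS (hp₀ : 1 < p₀) (hpq : p₀ < q) (hq₀ : 0 < q₀) :
    EndpointFunctional p₀ q₀ p₁ q (hardyS p₀ p₁ q) where
  measurable _ := measurable_hardyS
  mono _ _ h _ ht := hardyS_mono h ht
  add_le _ _ hw _ t := hardyS_add_le hw t
  const_mul c _ hw t := hardyS_const_mul hw c t
  weak_bound := by
    have hp₀_pos : 0 < p₀ := by linarith
    refine ⟨(1 / (1 / p₀ - 1 / q)).toNNReal * (1 / (1 - 1 / p₀)).toNNReal *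
      ((q₀ / p₀) ^ (1 / q₀)).toNNReal, fun φ hφ t ht => ?_⟩
    refine (hardyS_mean_le hp₀ hpq ht fun v hv =>
      (rpow_mul_le_lintegral_of_antitone hφ hp₀_pos hq₀ hv).trans
        (mul_le_mul_right (ENNReal.rpow_le_rpow (lintegral_mono_set Ioo_subset_Ioi_self)
          (by positivity)) _)).trans_eq ?_
    simp only [ENNReal.coe_mul, ENNReal.ofReal]
    ring
  strong_bound := ⟨_, fun _ hφ _ ht => hardyS_mean_le_const (hp₀.trans hpq) hφ.measurable ht⟩

end HardyOperators

/-! ### Averages over initial sets -/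

namespace LengthMap

variable {α : Type*} [MeasurableSpace α] {μ : Measure α} (L : LengthMap μ) {g h : α → ℝ≥0∞}

/-- The average of `g` over `L.initial s`. Unlike the rearrangement, which it replaces in
`hardyR` and `hardyS`, it is additive in `g`. -/
def avg (g : α → ℝ≥0∞) (s : ℝ) : ℝ≥0∞ := ENNReal.ofReal (s ^ (-1 : ℝ)) * ∫⁻ x in L.initial s, g x ∂μ

@[fun_prop]
theorem measurable_avg (g : α → ℝ≥0∞) : Measurable (L.avg g) := by
  have hmono : Monotone fun s : ℝ => ∫⁻ x in L.initial s, g x ∂μ := fun s t hst =>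
    lintegral_mono_set fun x hx => ⟨lt_of_lt_of_le hx.1 hst, hx.2⟩
  exact (measurable_ofReal_rpow _).mul hmono.measurable

theorem avg_le_mean (hg : Measurable g) (s : ℝ) : L.avg g s ≤ mean (rearr μ g) s :=
  mul_le_mul_right (setLIntegral_le_lintegral_rearr hg (L.measure_initial_le s)) _

theorem avg_mono (hgh : g ≤ᵐ[μ] h) (s : ℝ) : L.avg g s ≤ L.avg h s :=
  mul_le_mul_right (lintegral_mono_ae (ae_restrict_of_ae hgh)) _

theorem avg_congr (hgh : g =ᵐ[μ] h) : L.avg g = L.avg h :=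
  funext fun s => le_antisymm (L.avg_mono hgh.le s) (L.avg_mono hgh.symm.le s)

theorem avg_add (hg : Measurable g) (h : α → ℝ≥0∞) (s : ℝ) :
    L.avg (fun x => g x + h x) s = L.avg g s + L.avg h s := by
  rw [avg, avg, avg, lintegral_add_left hg, mul_add]

theorem avg_const_mul (hg : Measurable g) (c : ℝ≥0∞) (s : ℝ) :
    L.avg (fun x => c * g x) s = c * L.avg g s := by
  rw [avg, avg, lintegral_const_mul _ hg, mul_left_comm]

theorem rearr_le_avg_pull (f : ℝ → ℝ≥0∞) {s : ℝ} (hs : 0 < s) :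
    rearr (halfLine μ) f s ≤ L.avg (L.pull (rearr (halfLine μ) f)) s := by
  rcases le_total (μ univ) (ENNReal.ofReal s) with h_out | h_in
  · rw [rearr_eq_zero_of_measure_univ_le f (by rwa [halfLine_univ])]
    exact zero_le
  have h_int : rearr (halfLine μ) f s * ENNReal.ofReal s ≤
      ∫⁻ t in Iio s, rearr (halfLine μ) f t ∂halfLine μ := by
    rw [← min_eq_left h_in, ← halfLine_Iio, ← setLIntegral_const]
    exact setLIntegral_mono' measurableSet_Iio fun t ht => rearr_antitone f (le_of_lt ht)
  rw [avg, L.setLIntegral_initial_pull (measurable_rearr f)]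
  refine le_trans (le_of_eq ?_) (mul_le_mul_right h_int _)
  rw [mul_left_comm, ← ENNReal.ofReal_mul (by positivity), Real.rpow_neg_one,
    inv_mul_cancel₀ hs.ne', ENNReal.ofReal_one, mul_one]

theorem avg_enorm_add_le (f g : α →ₘ[μ] ℝ) (s : ℝ) :
    L.avg (fun x => ‖(f + g) x‖ₑ) s ≤ L.avg (fun x => ‖f x‖ₑ) s + L.avg (fun x => ‖g x‖ₑ) s := by
  rw [← L.avg_add f.measurable.enorm]
  refine L.avg_mono ?_ s
  filter_upwards [AEEqFun.coeFn_add f g] with x hx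
  rw [hx]
  exact enorm_add_le _ _

theorem avg_enorm_smul (a : ℝ) (f : α →ₘ[μ] ℝ) :
    L.avg (fun x => ‖(a • f) x‖ₑ) = fun s => ‖a‖ₑ * L.avg (fun x => ‖f x‖ₑ) s := by
  ext s
  rw [← L.avg_const_mul f.measurable.enorm]
  refine congrFun (L.avg_congr ?_) s
  filter_upwards [AEEqFun.coeFn_smul a f] with x hx
  rw [hx, Pi.smul_apply, enorm_smul]

end LengthMap

/-! ### Sublinear operators built from averages -/

namespace LengthMap

variable {α : Type*} [MeasurableSpace α] {μ : Measure α} (L : LengthMap μ)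

theorem ae_pull_eq :
    ∀ᵐ x ∂μ, (∃ t, 0 < t ∧ ∀ h, L.pull h x = h t) ∨ ∀ h, L.pull h x = 0 := by
  filter_upwards [L.ae_toFun_pos] with x hx
  by_cases hmem : x ∈ L.carrier
  · exact Or.inl ⟨L.toFun x, hx hmem, fun h => indicator_of_mem hmem _⟩
  · exact Or.inr fun h => indicator_of_notMem hmem _

end LengthMap

theorem rearr_halfLine_le_of_antitoneOn {α : Type*} [MeasurableSpace α] {μ : Measure α}
    {h k : ℝ → ℝ≥0∞} (hk : AntitoneOn k (Ioi 0)) (hhk : ∀ s, 0 < s → h s ≤ k s) {t : ℝ}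
    (ht : 0 < t) : rearr (halfLine μ) h t ≤ k t := by
  have hsub : {s | k t < h s} ⊆ Iio t := fun s hs => by
    by_contra hts
    have hts : t ≤ s := not_lt.1 hts
    have hs_pos : 0 < s := ht.trans_le hts
    exact hs.not_ge ((hhk s hs_pos).trans (hk ht hs_pos hts))
  refine rearr_le_iff.2 ((measure_mono hsub).trans ?_)
  rw [halfLine_Iio]
  exact min_le_left _ _

section AvgOperator

variable {α β : Type*} [MeasurableSpace α] [MeasurableSpace β] {μ : Measure α} {ν : Measure β}
  {p₀ q₀ p₁ q t : ℝ} {Φ : (ℝ → ℝ≥0∞) → ℝ → ℝ≥0∞}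

theorem rearrAbs_antitone (f : α →ₘ[μ] ℝ) : Antitone (rearrAbs f) := rearr_antitone _

theorem lorentz_one (q : ℝ) (f : α →ₘ[μ] ℝ) : lorentz q 1 f =
    ∫⁻ s in Ioi (0 : ℝ), ENNReal.ofReal (s ^ (1 / q - 1)) * rearrAbs f s := by
  simp [lorentz]

/-- The functional `Φ` evaluated on the averages of `|f|`, a function on the half-line that depends
sublinearly on `f`. -/
def avgFunctional (Φ : (ℝ → ℝ≥0∞) → ℝ → ℝ≥0∞) (L : LengthMap μ) (f : α →ₘ[μ] ℝ) : ℝ → ℝ≥0∞ :=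
  Φ (L.avg fun x => ‖f x‖ₑ)

namespace EndpointFunctional

section

variable (hΦ : EndpointFunctional p₀ q₀ p₁ q Φ) (L : LengthMap μ)
include hΦ

theorem measurable_avgFunctional (f : α →ₘ[μ] ℝ) : Measurable (avgFunctional Φ L f) :=
  hΦ.measurable _

theorem avgFunctional_add_le (f g : α →ₘ[μ] ℝ) (ht : 0 < t) :
    avgFunctional Φ L (f + g) t ≤ avgFunctional Φ L f t + avgFunctional Φ L g t :=
  (hΦ.mono _ _ (fun s _ => L.avg_enorm_add_le f g s) t ht).trans
    (hΦ.add_le _ _ (L.measurable_avg _) (L.measurable_avg _) t)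

theorem avgFunctional_smul (a : ℝ) (f : α →ₘ[μ] ℝ) (t : ℝ) :
    avgFunctional Φ L (a • f) t = ‖a‖ₑ * avgFunctional Φ L f t := by
  rw [avgFunctional, L.avg_enorm_smul, hΦ.const_mul _ _ (L.measurable_avg _), avgFunctional]

theorem avgFunctional_le_mean (f : α →ₘ[μ] ℝ) (ht : 0 < t) :
    avgFunctional Φ L f t ≤ Φ (mean (rearrAbs f)) t :=
  hΦ.mono _ _ (fun s _ => L.avg_le_mean f.measurable.enorm s) t ht

theorem exists_avgFunctional_le_lorentz :
    ∃ C : ℝ≥0, ∀ f : α →ₘ[μ] ℝ, ∀ t, 0 < t →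
      avgFunctional Φ L f t ≤ C * ENNReal.ofReal (t ^ (-(1 / p₁))) * lorentz p₀ q₀ f := by
  obtain ⟨C, hC⟩ := hΦ.weak_bound
  exact ⟨C, fun f t ht => (hΦ.avgFunctional_le_mean L f ht).trans (hC _ (rearrAbs_antitone f) t ht)⟩

theorem exists_avgFunctional_le_lorentz_one :
    ∃ C : ℝ≥0, ∀ f : α →ₘ[μ] ℝ, ∀ t, 0 < t → avgFunctional Φ L f t ≤ C * lorentz q 1 f := by
  obtain ⟨C, hC⟩ := hΦ.strong_bound
  refine ⟨C, fun f t ht => (hΦ.avgFunctional_le_mean L f ht).trans ?_⟩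
  rw [lorentz_one]
  exact hC _ (rearrAbs_antitone f) t ht

theorem avgFunctional_lt_top {f : α →ₘ[μ] ℝ} (hf : f ∈ lorentzSum μ p₀ q₀ q) (ht : 0 < t) :
    avgFunctional Φ L f t < ∞ := by
  obtain ⟨f₀, f₁, h₀, h₁, rfl⟩ := hf
  obtain ⟨C₀, hC₀⟩ := hΦ.exists_avgFunctional_le_lorentz L
  obtain ⟨C₁, hC₁⟩ := hΦ.exists_avgFunctional_le_lorentz_one L
  refine (hΦ.avgFunctional_add_le L f₀ f₁ ht).trans_lt (ENNReal.add_lt_top.2 ⟨?_, ?_⟩)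
  · exact (hC₀ f₀ t ht).trans_lt (ENNReal.mul_lt_top
      (ENNReal.mul_lt_top ENNReal.coe_lt_top ENNReal.ofReal_lt_top) h₀)
  · exact (hC₁ f₁ t ht).trans_lt (ENNReal.mul_lt_top ENNReal.coe_lt_top h₁)

end

/-- The operator that pulls `avgFunctional Φ L f` back to the target space. On `lorentzSum` the
functional is finite, so that `ENNReal.toReal` loses nothing there. -/
def avgOperator (hΦ : EndpointFunctional p₀ q₀ p₁ q Φ) (L : LengthMap μ) (L' : LengthMap ν)
    (f : α →ₘ[μ] ℝ) : β →ₘ[ν] ℝ :=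
  AEEqFun.mk (fun y => (L'.pull (avgFunctional Φ L f) y).toReal)
    (L'.measurable_pull (hΦ.measurable_avgFunctional L f)).ennreal_toReal.aestronglyMeasurable

variable (hΦ : EndpointFunctional p₀ q₀ p₁ q Φ) (L : LengthMap μ) (L' : LengthMap ν)

theorem coeFn_avgOperator (f : α →ₘ[μ] ℝ) :
    ∀ᵐ y ∂ν, hΦ.avgOperator L L' f y = (L'.pull (avgFunctional Φ L f) y).toReal :=
  AEEqFun.coeFn_mk _ _

theorem enorm_avgOperator_le (f : α →ₘ[μ] ℝ) :
    ∀ᵐ y ∂ν, ‖hΦ.avgOperator L L' f y‖ₑ ≤ L'.pull (avgFunctional Φ L f) y := by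
  filter_upwards [hΦ.coeFn_avgOperator L L' f] with y hy
  rw [hy, Real.enorm_of_nonneg ENNReal.toReal_nonneg]
  exact ENNReal.ofReal_toReal_le

theorem enorm_avgOperator {f : α →ₘ[μ] ℝ} (hf : f ∈ lorentzSum μ p₀ q₀ q) :
    ∀ᵐ y ∂ν, ‖hΦ.avgOperator L L' f y‖ₑ = L'.pull (avgFunctional Φ L f) y := by
  filter_upwards [hΦ.coeFn_avgOperator L L' f, L'.ae_pull_eq] with y hy hpull
  rw [hy, Real.enorm_of_nonneg ENNReal.toReal_nonneg, ENNReal.ofReal_toReal]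
  rcases hpull with ⟨t, ht, hpull⟩ | hpull <;> rw [hpull]
  · exact (hΦ.avgFunctional_lt_top L hf ht).ne
  · exact ENNReal.zero_ne_top

theorem abs_avgOperator_add_le {f g : α →ₘ[μ] ℝ} (hf : f ∈ lorentzSum μ p₀ q₀ q)
    (hg : g ∈ lorentzSum μ p₀ q₀ q) :
    ∀ᵐ y ∂ν, |hΦ.avgOperator L L' (f + g) y| ≤
      |hΦ.avgOperator L L' f y| + |hΦ.avgOperator L L' g y| := by
  filter_upwards [hΦ.enorm_avgOperator_le L L' (f + g), hΦ.enorm_avgOperator L L' hf,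
    hΦ.enorm_avgOperator L L' hg, L'.ae_pull_eq] with y hfg_y hf_y hg_y hpull
  have hadd : L'.pull (avgFunctional Φ L (f + g)) y ≤
      L'.pull (avgFunctional Φ L f) y + L'.pull (avgFunctional Φ L g) y := by
    rcases hpull with ⟨t, ht, hpull⟩ | hpull <;> simp only [hpull]
    · exact hΦ.avgFunctional_add_le L f g ht
    · exact zero_le
  have henorm := hfg_y.trans hadd
  rw [← hf_y, ← hg_y] at henorm
  simp only [Real.enorm_eq_ofReal_abs] at henorm
  rwa [← ENNReal.ofReal_add (abs_nonneg _) (abs_nonneg _),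
    ENNReal.ofReal_le_ofReal_iff (by positivity)] at henorm

theorem abs_avgOperator_smul (a : ℝ) (f : α →ₘ[μ] ℝ) :
    ∀ᵐ y ∂ν, |hΦ.avgOperator L L' (a • f) y| = |a| * |hΦ.avgOperator L L' f y| := by
  filter_upwards [hΦ.coeFn_avgOperator L L' f, hΦ.coeFn_avgOperator L L' (a • f),
    L'.ae_pull_eq] with y hf_y haf_y hpull
  rw [hf_y, haf_y]
  rcases hpull with ⟨t, -, hpull⟩ | hpull
  · simp [hpull, hΦ.avgFunctional_smul, ENNReal.toReal_mul]
  · simp [hpull]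

theorem sublinear_avgOperator : Sublinear (lorentzSum μ p₀ q₀ q) (hΦ.avgOperator L L') := by
  refine ⟨fun f hf g hg => ?_, fun a f _ => hΦ.abs_avgOperator_smul L L' a f⟩
  simpa only [one_mul] using hΦ.abs_avgOperator_add_le L L' hf hg

theorem boundedFrom_weakLorentz_avgOperator (hp₁ : 0 ≤ p₁) :
    BoundedFrom (lorentz p₀ q₀) (weakLorentz p₁) (hΦ.avgOperator L L') := by
  obtain ⟨C, hC⟩ := hΦ.exists_avgFunctional_le_lorentz L
  refine ⟨C, fun f _ => iSup₂_le fun t ht => ?_⟩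
  have hanti : AntitoneOn
      (fun s : ℝ => C * ENNReal.ofReal (s ^ (-(1 / p₁))) * lorentz p₀ q₀ f) (Ioi 0) := by
    intro s hs s' _ hss'
    dsimp only
    gcongr C * ENNReal.ofReal ?_ * _
    exact Real.rpow_le_rpow_of_nonpos hs hss' (by simpa using hp₁)
  have hrearr : rearrAbs (hΦ.avgOperator L L' f) t ≤
      C * ENNReal.ofReal (t ^ (-(1 / p₁))) * lorentz p₀ q₀ f := by
    refine (rearr_mono_ae (hΦ.enorm_avgOperator_le L L' f) t).trans ?_
    rw [L'.rearr_pull (hΦ.measurable_avgFunctional L f)]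
    exact rearr_halfLine_le_of_antitoneOn hanti (hC f) ht
  refine (mul_le_mul_right hrearr _).trans_eq ?_
  rw [← mul_assoc, mul_left_comm, ofReal_rpow_mul_rpow ht, add_neg_cancel, Real.rpow_zero,
    ENNReal.ofReal_one, mul_one]

theorem boundedFrom_supNorm_avgOperator :
    BoundedFrom (lorentz q 1) supNorm (hΦ.avgOperator L L') := by
  obtain ⟨C, hC⟩ := hΦ.exists_avgFunctional_le_lorentz_one L
  refine ⟨C, fun f _ => ?_⟩
  rw [supNorm, eLpNorm_exponent_top]
  refine essSup_le_of_ae_le _ ?_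
  filter_upwards [hΦ.enorm_avgOperator_le L L' f, L'.ae_pull_eq] with y hy hpull
  refine hy.trans ?_
  rcases hpull with ⟨t, ht, hpull⟩ | hpull <;> rw [hpull]
  · exact hC f t ht
  · exact zero_le

end EndpointFunctional

end AvgOperator

section AngleFun

variable {β : Type*} [MeasurableSpace β] {ν : Measure β}

/-- The function `t ↦ t^{-1/p} sup_{0 < s ≤ t} s^{1/p} f^*(s)`, so that `ρ.angleNorm p f` is
`ρ.repr (angleFun p f)`. -/
def angleFun (p : ℝ) (f : β →ₘ[ν] ℝ) (t : ℝ) : ℝ≥0∞ :=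
  ENNReal.ofReal (t ^ (-(1 / p))) *
    ⨆ (s : ℝ) (_ : 0 < s ∧ s ≤ t), ENNReal.ofReal (s ^ (1 / p)) * rearrAbs f s

theorem measurable_angleFun (p : ℝ) (f : β →ₘ[ν] ℝ) : Measurable (angleFun p f) := by
  have hmono : Monotone fun t : ℝ =>
      ⨆ (s : ℝ) (_ : 0 < s ∧ s ≤ t), ENNReal.ofReal (s ^ (1 / p)) * rearrAbs f s :=
    fun t t' htt' => iSup₂_le fun s hs => le_iSup₂_of_le s ⟨hs.1, hs.2.trans htt'⟩ le_rfl
  exact (measurable_ofReal_rpow _).mul hmono.measurable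

theorem rearrAbs_le_angleFun (p : ℝ) (f : β →ₘ[ν] ℝ) {t : ℝ} (ht : 0 < t) :
    rearrAbs f t ≤ angleFun p f t :=
  calc rearrAbs f t
      = ENNReal.ofReal (t ^ (-(1 / p))) * (ENNReal.ofReal (t ^ (1 / p)) * rearrAbs f t) := by
        rw [← mul_assoc, ofReal_rpow_mul_rpow ht, neg_add_cancel, Real.rpow_zero,
          ENNReal.ofReal_one, one_mul]
    _ ≤ angleFun p f t := mul_le_mul_right (le_iSup₂ (f := fun (s : ℝ) (_ : 0 < s ∧ s ≤ t) =>
        ENNReal.ofReal (s ^ (1 / p)) * rearrAbs f s) t ⟨ht, le_rfl⟩) _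

theorem RINorm.norm_le_angleNorm (hν : Nonatomic ν) (ρ : RINorm ν) (p : ℝ) (f : β →ₘ[ν] ℝ) :
    ρ.norm f ≤ ρ.angleNorm p f := by
  rw [← ρ.repr_rearrAbs]
  exact ρ.repr_mono hν (measurable_rearr _) (measurable_angleFun p f) fun t ht =>
    rearrAbs_le_angleFun p f ht

end AngleFun

section Necessity

variable {α β : Type*} [MeasurableSpace α] [MeasurableSpace β] {μ : Measure α} {ν : Measure β}
  {p₀ q₀ p₁ q : ℝ} {Φ : (ℝ → ℝ≥0∞) → ℝ → ℝ≥0∞}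

theorem RINorm.exists_enorm_ae_eq_pull_rearr (hμ : Nonatomic μ) (L : LengthMap μ) (X : RINorm μ)
    {f : ℝ → ℝ≥0∞} (hfX : X.repr f < ∞) :
    ∃ g : α →ₘ[μ] ℝ, (fun x => ‖g x‖ₑ) =ᵐ[μ] L.pull (rearr (halfLine μ) f) ∧
      X.norm g = X.repr f := by
  have hmeas := L.measurable_pull (measurable_rearr (μ := halfLine μ) f)
  have hrepr : X.repr f = X.toFun (L.pull (rearr (halfLine μ) f)) :=
    X.repr_eq_of_rearr_eq hmeas fun t _ => by
      rw [L.rearr_pull (measurable_rearr f), rearr_rearr_halfLine]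
  obtain ⟨g, hg⟩ := X.exists_enorm_ae_eq hμ hmeas (hrepr ▸ hfX)
  exact ⟨g, hg, (X.congr_ae g.measurable.enorm hmeas hg).trans hrepr.symm⟩

theorem RINorm.norm_avgOperator (Y : RINorm ν) (hΦ : EndpointFunctional p₀ q₀ p₁ q Φ)
    (L : LengthMap μ) (L' : LengthMap ν) {f : α →ₘ[μ] ℝ} (hf : f ∈ lorentzSum μ p₀ q₀ q) :
    Y.norm (hΦ.avgOperator L L' f) = Y.repr (avgFunctional Φ L f) := by
  rw [Y.repr_eq_pull L' (hΦ.measurable_avgFunctional L f)]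
  exact Y.congr_ae (AEEqFun.measurable _).enorm
    (L'.measurable_pull (hΦ.measurable_avgFunctional L f)) (hΦ.enorm_avgOperator L L' hf)

theorem EndpointFunctional.boundedRepr (hΦ : EndpointFunctional p₀ q₀ p₁ q Φ) (hμ : Nonatomic μ)
    (hν : Nonatomic ν) (hp₁ : 0 ≤ p₁) {X : RINorm μ} {Y : RINorm ν}
    (hX : ∀ f : α →ₘ[μ] ℝ, X.norm f < ∞ → f ∈ lorentzSum μ p₀ q₀ q)
    (hbdd : ∀ T : (α →ₘ[μ] ℝ) → (β →ₘ[ν] ℝ), Sublinear (lorentzSum μ p₀ q₀ q) T →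
      EndpointBounds p₀ q₀ p₁ q T → BoundedFrom X.norm (Y.angleNorm p₁) T) :
    BoundedRepr X Y fun f => Φ (rearr (halfLine μ) f) := by
  obtain ⟨L⟩ := hμ.nonempty_lengthMap
  obtain ⟨L'⟩ := hν.nonempty_lengthMap
  obtain ⟨C, hC⟩ := hbdd (hΦ.avgOperator L L') (hΦ.sublinear_avgOperator L L')
    ⟨hΦ.boundedFrom_weakLorentz_avgOperator L L' hp₁, hΦ.boundedFrom_supNorm_avgOperator L L'⟩
  refine ⟨C, fun f _ hfX => ?_⟩
  obtain ⟨g, hg, hgX⟩ := X.exists_enorm_ae_eq_pull_rearr hμ L hfX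
  have hg_fin : X.norm g < ∞ := hgX ▸ hfX
  calc Y.repr (Φ (rearr (halfLine μ) f))
      ≤ Y.repr (avgFunctional Φ L g) := by
        refine Y.repr_mono hν (hΦ.measurable _) (hΦ.measurable_avgFunctional L g)
          (hΦ.mono _ _ fun s hs => ?_)
        rw [L.avg_congr hg]
        exact L.rearr_le_avg_pull f hs
    _ = Y.norm (hΦ.avgOperator L L' g) := (Y.norm_avgOperator hΦ L L' (hX g hg_fin)).symm
    _ ≤ Y.angleNorm p₁ (hΦ.avgOperator L L' g) := Y.norm_le_angleNorm hν p₁ _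
    _ ≤ C * X.norm g := hC g hg_fin
    _ = C * X.repr f := by rw [hgX]

end Necessity

/-! ### Truncation and interpolation -/

section Truncation

variable {α : Type*} [MeasurableSpace α] {μ : Measure α} {p₀ q₀ p₁ q t u : ℝ} {l : ℝ≥0}

theorem abs_max_neg_min (l : ℝ≥0) (a : ℝ) : |max (-(l : ℝ)) (min l a)| = min (l : ℝ) |a| := by
  have := l.coe_nonneg
  grind

theorem abs_sub_max_neg_min (l : ℝ≥0) (a : ℝ) :
    |a - max (-(l : ℝ)) (min l a)| = max 0 (|a| - l) := by
  have := l.coe_nonneg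
  grind

/-- The truncation of `f` to values in `[-l, l]`. -/
def truncate (l : ℝ≥0) (f : α →ₘ[μ] ℝ) : α →ₘ[μ] ℝ :=
  AEEqFun.comp (fun x => max (-(l : ℝ)) (min l x)) (by fun_prop) f

theorem coeFn_truncate (l : ℝ≥0) (f : α →ₘ[μ] ℝ) :
    ∀ᵐ x ∂μ, truncate l f x = max (-(l : ℝ)) (min l (f x)) :=
  AEEqFun.coeFn_comp _ _ f

theorem enorm_truncate (l : ℝ≥0) (f : α →ₘ[μ] ℝ) :
    ∀ᵐ x ∂μ, ‖truncate l f x‖ₑ = min (l : ℝ≥0∞) ‖f x‖ₑ := by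
  filter_upwards [coeFn_truncate l f] with x hx
  rw [hx, Real.enorm_eq_ofReal_abs, abs_max_neg_min,
    ENNReal.ofReal_min, ENNReal.ofReal_coe_nnreal, Real.enorm_eq_ofReal_abs]

theorem enorm_sub_truncate (l : ℝ≥0) (f : α →ₘ[μ] ℝ) :
    ∀ᵐ x ∂μ, ‖(f - truncate l f) x‖ₑ = ‖f x‖ₑ - l := by
  filter_upwards [AEEqFun.coeFn_sub f (truncate l f), coeFn_truncate l f] with x hsub hx
  rw [hsub, Pi.sub_apply, hx, Real.enorm_eq_ofReal_abs,
    abs_sub_max_neg_min, ENNReal.ofReal_max, ENNReal.ofReal_zero, max_eq_right zero_le,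
    ENNReal.ofReal_sub _ l.coe_nonneg, ENNReal.ofReal_coe_nnreal, Real.enorm_eq_ofReal_abs]

theorem rearrAbs_truncate_le (l : ℝ≥0) (f : α →ₘ[μ] ℝ) (s : ℝ) :
    rearrAbs (truncate l f) s ≤ rearrAbs f s :=
  rearr_mono_ae ((enorm_truncate l f).mono fun _ hx => hx.trans_le (min_le_right _ _)) s

theorem rearrAbs_truncate_le_const (l : ℝ≥0) (f : α →ₘ[μ] ℝ) (s : ℝ) :
    rearrAbs (truncate l f) s ≤ l := by
  refine rearr_le_iff.2 (le_of_eq_of_le (measure_eq_zero_iff_ae_notMem.2 ?_) zero_le)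
  exact (enorm_truncate l f).mono fun _ hx => not_lt.2 (hx.trans_le (min_le_left _ _))

theorem rearrAbs_sub_truncate_le (l : ℝ≥0) (f : α →ₘ[μ] ℝ) (s : ℝ) :
    rearrAbs (f - truncate l f) s ≤ rearrAbs f s :=
  rearr_mono_ae ((enorm_sub_truncate l f).mono fun _ hx => hx.trans_le tsub_le_self) s

theorem rearrAbs_sub_truncate_eq_zero {f : α →ₘ[μ] ℝ} {s : ℝ} (h : rearrAbs f s ≤ l) :
    rearrAbs (f - truncate l f) s = 0 := by
  refine nonpos_iff_eq_zero.1 (rearr_le_iff.2 ((measure_mono_ae ?_).trans (rearr_le_iff.1 h)))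
  filter_upwards [enorm_sub_truncate l f] with x hx hpos
  exact tsub_pos_iff_lt.1 (hx ▸ hpos)

theorem lorentz_sub_truncate_le (hq₀ : 0 < q₀) {f : α →ₘ[μ] ℝ} (h : rearrAbs f u ≤ l) :
    lorentz p₀ q₀ (f - truncate l f) ≤
      (∫⁻ s in Ioo 0 u, ENNReal.ofReal (s ^ (q₀ / p₀ - 1)) * rearrAbs f s ^ q₀) ^ (1 / q₀) := by
  refine ENNReal.rpow_le_rpow ?_ (by positivity)
  rw [← Iio_inter_Ioi, ← Measure.restrict_restrict measurableSet_Iio,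
    ← lintegral_indicator measurableSet_Iio]
  refine lintegral_mono fun s => ?_
  rcases lt_or_ge s u with hs | hs
  · rw [indicator_of_mem (mem_Iio.2 hs)]
    gcongr
    exact rearrAbs_sub_truncate_le l f s
  · rw [rearrAbs_sub_truncate_eq_zero ((rearrAbs_antitone f hs).trans h),
      ENNReal.zero_rpow_of_pos hq₀, mul_zero]
    exact zero_le

theorem lorentz_truncate_le (hq : 0 < q) (hu : 0 ≤ u) (l : ℝ≥0) (f : α →ₘ[μ] ℝ) :
    lorentz q 1 (truncate l f) ≤ ENNReal.ofReal q * (ENNReal.ofReal (u ^ (1 / q)) * l) +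
      ∫⁻ s in Ioi u, ENNReal.ofReal (s ^ (1 / q - 1)) * rearrAbs f s := by
  rw [lorentz_one, ← Ioc_union_Ioi_eq_Ioi hu]
  refine (lintegral_union_le _ _ _).trans (add_le_add ?_ ?_)
  · calc ∫⁻ s in Ioc 0 u, ENNReal.ofReal (s ^ (1 / q - 1)) * rearrAbs (truncate l f) s
        ≤ ∫⁻ s in Ioc 0 u, ENNReal.ofReal (s ^ (1 / q - 1)) * l :=
          lintegral_mono fun s => mul_le_mul_right (rearrAbs_truncate_le_const l f s) _
      _ = ENNReal.ofReal q * (ENNReal.ofReal (u ^ (1 / q)) * l) := by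
          rw [lintegral_mul_const _ (by fun_prop), ← restrict_Ioo_eq_restrict_Ioc,
            lintegral_Ioo_rpow (by positivity) hu, div_eq_mul_one_div, one_div_one_div,
            mul_comm (u ^ _), ENNReal.ofReal_mul hq.le, mul_assoc]
  · exact lintegral_mono fun s => mul_le_mul_right (rearrAbs_truncate_le l f s) _

theorem lintegral_rpow_eq_rpow_mul_hardyR (ht : 0 < t) (w : ℝ → ℝ≥0∞) :
    (∫⁻ s in Ioo 0 (t ^ slope p₀ p₁ q),
      ENNReal.ofReal (s ^ (q₀ / p₀ - 1)) * w s ^ q₀) ^ (1 / q₀) =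
      ENNReal.ofReal (t ^ (1 / p₁)) * hardyR p₀ q₀ p₁ q w t := by
  rw [hardyR, ← mul_assoc, ofReal_rpow_mul_rpow ht, add_neg_cancel, Real.rpow_zero,
    ENNReal.ofReal_one, one_mul]

theorem rpow_mul_le_hardyR (hp₀ : 0 < p₀) (hpq : p₀ < q) (hq₀ : 0 < q₀) (ht : 0 < t)
    {φ : ℝ → ℝ≥0∞} (hφ : Antitone φ) :
    ENNReal.ofReal ((t ^ slope p₀ p₁ q) ^ (1 / q)) * φ (t ^ slope p₀ p₁ q) ≤
      ENNReal.ofReal ((q₀ / p₀) ^ (1 / q₀)) * hardyR p₀ q₀ p₁ q φ t := by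
  have hu : 0 < t ^ slope p₀ p₁ q := Real.rpow_pos_of_pos ht _
  have hpow : (t ^ slope p₀ p₁ q) ^ (-(1 / p₀ - 1 / q)) = t ^ (-(1 / p₁)) := by
    rw [← Real.rpow_mul ht.le, mul_neg, slope_mul_sub hp₀.ne' (hp₀.trans hpq).ne' hpq.ne]
  have hexp : 1 / q = -(1 / p₀ - 1 / q) + 1 / p₀ := by ring
  rw [hexp, ← ofReal_rpow_mul_rpow hu, hpow, hardyR, mul_assoc,
    mul_left_comm (ENNReal.ofReal ((q₀ / p₀) ^ (1 / q₀)))]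
  exact mul_le_mul_right (rpow_mul_le_lintegral_of_antitone hφ hp₀ hq₀ hu) _

theorem exists_truncate_le_hardy (hp₀ : 0 < p₀) (hpq : p₀ < q) (hq₀ : 0 < q₀) (ht : 0 < t)
    {f : α →ₘ[μ] ℝ} (hf : hardyR p₀ q₀ p₁ q (rearrAbs f) t ≠ ∞) :
    ∃ l : ℝ≥0,
      lorentz p₀ q₀ (f - truncate l f) ≤
        ENNReal.ofReal (t ^ (1 / p₁)) * hardyR p₀ q₀ p₁ q (rearrAbs f) t ∧
      lorentz q 1 (truncate l f) ≤
        ENNReal.ofReal q * ENNReal.ofReal ((q₀ / p₀) ^ (1 / q₀)) *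
          hardyR p₀ q₀ p₁ q (rearrAbs f) t + hardyS p₀ p₁ q (rearrAbs f) t := by
  have hu : 0 < t ^ slope p₀ p₁ q := Real.rpow_pos_of_pos ht _
  have hlevel := rpow_mul_le_hardyR (p₁ := p₁) hp₀ hpq hq₀ ht (rearrAbs_antitone f)
  have hfin : rearrAbs f (t ^ slope p₀ p₁ q) ≠ ∞ := by
    intro h_top
    rw [h_top, ENNReal.mul_top (ENNReal.ofReal_pos.2 (by positivity)).ne'] at hlevel
    exact ENNReal.mul_ne_top ENNReal.ofReal_ne_top hf (top_unique hlevel)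
  lift rearrAbs f (t ^ slope p₀ p₁ q) to ℝ≥0 using hfin with l hl
  refine ⟨l, ?_, ?_⟩
  · rw [← lintegral_rpow_eq_rpow_mul_hardyR ht]
    exact lorentz_sub_truncate_le hq₀ hl.ge
  · refine (lorentz_truncate_le (hp₀.trans hpq) hu.le l f).trans (add_le_add_left ?_ _)
    rw [mul_assoc]
    exact mul_le_mul_right hlevel _

theorem lorentz_zero (p : ℝ) (hq : 0 < q) : lorentz p q (0 : α →ₘ[μ] ℝ) = 0 := by
  have hrearr (t : ℝ) : rearrAbs (0 : α →ₘ[μ] ℝ) t = 0 := by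
    refine nonpos_iff_eq_zero.1 (rearr_le_iff.2
      (le_of_eq_of_le (measure_eq_zero_iff_ae_notMem.2 ?_) zero_le))
    filter_upwards [AEEqFun.coeFn_zero (α := α) (β := ℝ) (μ := μ)] with x hx
    simp [hx]
  simp [lorentz, hrearr, ENNReal.zero_rpow_of_pos hq, hq]

theorem mem_lorentzSum_left {f : α →ₘ[μ] ℝ} (hf : lorentz p₀ q₀ f < ∞) :
    f ∈ lorentzSum μ p₀ q₀ q :=
  ⟨f, 0, hf, (lorentz_zero q one_pos).trans_lt ENNReal.zero_lt_top, (add_zero f).symm⟩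

theorem mem_lorentzSum_right (hq₀ : 0 < q₀) {f : α →ₘ[μ] ℝ} (hf : lorentz q 1 f < ∞) :
    f ∈ lorentzSum μ p₀ q₀ q :=
  ⟨0, f, (lorentz_zero p₀ hq₀).trans_lt ENNReal.zero_lt_top, hf, (zero_add f).symm⟩

end Truncation

section Interpolation

variable {α β : Type*} [MeasurableSpace α] [MeasurableSpace β] {μ : Measure α} {ν : Measure β}
  {p p₀ q₀ p₁ q t : ℝ} {k : ℝ≥0} {h h₀ h₁ : β →ₘ[ν] ℝ}

theorem rearrAbs_le_of_abs_le (hk : ∀ᵐ y ∂ν, |h y| ≤ k * (|h₀ y| + |h₁ y|)) (s : ℝ) :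
    rearrAbs h s ≤ k * (rearrAbs h₀ s + supNorm h₁) := by
  refine rearr_le_iff.2 ((measure_mono_ae ?_).trans (rearr_le_iff.1 (le_refl (rearrAbs h₀ s))))
  filter_upwards [hk, enorm_ae_le_eLpNormEssSup h₁ ν] with y hy hy₁ hlt
  have henorm : ‖h y‖ₑ ≤ k * (‖h₀ y‖ₑ + ‖h₁ y‖ₑ) := by
    simp only [Real.enorm_eq_ofReal_abs]
    rw [← ENNReal.ofReal_add (abs_nonneg _) (abs_nonneg _), ← ENNReal.ofReal_coe_nnreal,
      ← ENNReal.ofReal_mul k.coe_nonneg]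
    exact ENNReal.ofReal_le_ofReal hy
  by_contra hle
  refine (lt_of_lt_of_le hlt henorm).not_ge ?_
  gcongr
  · exact not_lt.1 hle
  · exact hy₁

theorem angleFun_le_of_abs_le (hp : 0 ≤ p) (ht : 0 < t)
    (hk : ∀ᵐ y ∂ν, |h y| ≤ k * (|h₀ y| + |h₁ y|)) :
    angleFun p h t ≤
      k * (ENNReal.ofReal (t ^ (-(1 / p))) * weakLorentz p h₀ + supNorm h₁) := by
  have hsup : (⨆ (s : ℝ) (_ : 0 < s ∧ s ≤ t), ENNReal.ofReal (s ^ (1 / p)) * rearrAbs h s) ≤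
      k * (weakLorentz p h₀ + ENNReal.ofReal (t ^ (1 / p)) * supNorm h₁) := by
    refine iSup₂_le fun s hs => ?_
    refine (mul_le_mul_right (rearrAbs_le_of_abs_le hk s) _).trans ?_
    rw [mul_left_comm, mul_add]
    gcongr
    · exact le_iSup₂ (f := fun (s : ℝ) (_ : 0 < s) =>
        ENNReal.ofReal (s ^ (1 / p)) * rearrAbs h₀ s) s hs.1
    · exact hs.1.le
    · exact hs.2
  refine (mul_le_mul_right hsup _).trans_eq ?_
  rw [mul_left_comm, mul_add, ← mul_assoc _ _ (supNorm h₁), ofReal_rpow_mul_rpow ht,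
    neg_add_cancel, Real.rpow_zero, ENNReal.ofReal_one, one_mul]

theorem angleFun_le_mul_add (hp : 0 ≤ p) (ht : 0 < t)
    (hk : ∀ᵐ y ∂ν, |h y| ≤ k * (|h₀ y| + |h₁ y|)) {C₀ C₁ c : ℝ≥0} {A B : ℝ≥0∞}
    (hweak : weakLorentz p h₀ ≤ C₀ * (ENNReal.ofReal (t ^ (1 / p)) * A))
    (hsup : supNorm h₁ ≤ C₁ * (c * A + B)) :
    angleFun p h t ≤ ↑(k * (C₀ + C₁ * (c + 1))) * (A + B) :=
  calc angleFun p h t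
      ≤ k * (ENNReal.ofReal (t ^ (-(1 / p))) * weakLorentz p h₀ + supNorm h₁) :=
        angleFun_le_of_abs_le hp ht hk
    _ ≤ k * (ENNReal.ofReal (t ^ (-(1 / p))) * (C₀ * (ENNReal.ofReal (t ^ (1 / p)) * A)) +
          C₁ * (c * A + B)) := by gcongr
    _ = k * (C₀ * A + C₁ * (c * A + B)) := by
        rw [mul_left_comm _ (C₀ : ℝ≥0∞), ← mul_assoc _ _ A, ofReal_rpow_mul_rpow ht,
          neg_add_cancel, Real.rpow_zero, ENNReal.ofReal_one, one_mul]
    _ ≤ k * (C₀ * (A + B) + C₁ * (c * (A + B) + (A + B))) := by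
        gcongr
        exacts [le_self_add, le_self_add, le_add_self]
    _ = ↑(k * (C₀ + C₁ * (c + 1))) * (A + B) := by
        push_cast
        ring

theorem exists_angleFun_le_hardy (hp₀ : 0 < p₀) (hpq : p₀ < q) (hp₁ : 0 ≤ p₁) (hq₀ : 0 < q₀)
    {T : (α →ₘ[μ] ℝ) → (β →ₘ[ν] ℝ)} (hT : Quasilinear (lorentzSum μ p₀ q₀ q) T)
    (hTb : EndpointBounds p₀ q₀ p₁ q T) :
    ∃ K : ℝ≥0, ∀ f t, 0 < t → angleFun p₁ (T f) t ≤
      K * (hardyR p₀ q₀ p₁ q (rearrAbs f) t + hardyS p₀ p₁ q (rearrAbs f) t) := by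
  obtain ⟨k, hk_one, hTk, -⟩ := hT
  obtain ⟨⟨C₀, hC₀⟩, C₁, hC₁⟩ := hTb
  lift k to ℝ≥0 using by linarith
  let c : ℝ≥0 := q.toNNReal * ((q₀ / p₀) ^ (1 / q₀)).toNNReal
  -- The summand `1` makes the constant nonzero, so that the bound is trivial where `R f* + S f*`
  -- is infinite.
  refine ⟨k * (C₀ + C₁ * (c + 1)) + 1, fun f t ht => ?_⟩
  generalize hR : hardyR p₀ q₀ p₁ q (rearrAbs f) t = R
  generalize hS : hardyS p₀ p₁ q (rearrAbs f) t = S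
  by_cases hRS : R + S = ∞
  · rw [hRS, ENNReal.mul_top (by simp)]
    exact le_top
  obtain ⟨hR_fin, hS_fin⟩ := ENNReal.add_ne_top.1 hRS
  obtain ⟨l, h₀, h₁⟩ := exists_truncate_le_hardy hp₀ hpq hq₀ ht (hR ▸ hR_fin)
  rw [hR] at h₀
  rw [hR, hS, ENNReal.ofReal, ENNReal.ofReal, ← ENNReal.coe_mul] at h₁
  have h₀_fin : lorentz p₀ q₀ (f - truncate l f) < ∞ :=
    h₀.trans_lt (ENNReal.mul_lt_top ENNReal.ofReal_lt_top hR_fin.lt_top)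
  have h₁_fin : lorentz q 1 (truncate l f) < ∞ := h₁.trans_lt
    (ENNReal.add_lt_top.2 ⟨ENNReal.mul_lt_top ENNReal.coe_lt_top hR_fin.lt_top, hS_fin.lt_top⟩)
  have hTf := hTk _ (mem_lorentzSum_left h₀_fin) _ (mem_lorentzSum_right hq₀ h₁_fin)
  rw [sub_add_cancel] at hTf
  refine (angleFun_le_mul_add hp₁ ht hTf ((hC₀ _ h₀_fin).trans (mul_le_mul_right h₀ _))
    ((hC₁ _ h₁_fin).trans (mul_le_mul_right h₁ _))).trans ?_
  gcongr
  exact le_self_add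

theorem boundedFrom_of_boundedRepr (hν : Nonatomic ν) (hp₀ : 0 < p₀) (hpq : p₀ < q)
    (hp₁ : 0 ≤ p₁) (hq₀ : 0 < q₀) {X : RINorm μ} {Y : RINorm ν}
    (hR : BoundedRepr X Y (calderonR (halfLine μ) p₀ q₀ p₁ q))
    (hS : BoundedRepr X Y (calderonS (halfLine μ) p₀ p₁ q))
    {T : (α →ₘ[μ] ℝ) → (β →ₘ[ν] ℝ)} (hT : Quasilinear (lorentzSum μ p₀ q₀ q) T)
    (hTb : EndpointBounds p₀ q₀ p₁ q T) : BoundedFrom X.norm (Y.angleNorm p₁) T := by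
  obtain ⟨K, hK⟩ := exists_angleFun_le_hardy hp₀ hpq hp₁ hq₀ hT hTb
  obtain ⟨CR, hCR⟩ := hR
  obtain ⟨CS, hCS⟩ := hS
  refine ⟨K * (CR + CS), fun f hf => ?_⟩
  have hfX : X.repr (rearrAbs f) < ∞ := by rwa [X.repr_rearrAbs]
  have hrearr : rearr (halfLine μ) (rearrAbs f) = rearrAbs f := funext (rearr_rearr _)
  have hRf : Y.repr (hardyR p₀ q₀ p₁ q (rearrAbs f)) ≤ CR * X.norm f :=
    calc Y.repr (hardyR p₀ q₀ p₁ q (rearrAbs f))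
        = Y.repr (calderonR (halfLine μ) p₀ q₀ p₁ q (rearrAbs f)) :=
          congrArg (fun w => Y.repr (hardyR p₀ q₀ p₁ q w)) hrearr.symm
      _ ≤ CR * X.norm f := X.repr_rearrAbs f ▸ hCR _ (measurable_rearr _) hfX
  have hSf : Y.repr (hardyS p₀ p₁ q (rearrAbs f)) ≤ CS * X.norm f :=
    calc Y.repr (hardyS p₀ p₁ q (rearrAbs f))
        = Y.repr (calderonS (halfLine μ) p₀ p₁ q (rearrAbs f)) :=
          congrArg (fun w => Y.repr (hardyS p₀ p₁ q w)) hrearr.symm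
      _ ≤ CS * X.norm f := X.repr_rearrAbs f ▸ hCS _ (measurable_rearr _) hfX
  have hmeas : Measurable (hardyR p₀ q₀ p₁ q (rearrAbs f) + hardyS p₀ p₁ q (rearrAbs f)) :=
    measurable_hardyR.add measurable_hardyS
  calc Y.angleNorm p₁ (T f)
      ≤ Y.repr fun t =>
          K * (hardyR p₀ q₀ p₁ q (rearrAbs f) + hardyS p₀ p₁ q (rearrAbs f)) t :=
        Y.repr_mono hν (measurable_angleFun p₁ (T f)) (hmeas.const_mul _) (hK f)
    _ = K * Y.repr (hardyR p₀ q₀ p₁ q (rearrAbs f) + hardyS p₀ p₁ q (rearrAbs f)) :=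
        Y.repr_const_mul hν K hmeas
    _ ≤ K * (CR * X.norm f + CS * X.norm f) := mul_le_mul_right
        ((Y.repr_add_le hν measurable_hardyR measurable_hardyS).trans (add_le_add hRf hSf)) _
    _ = ↑(K * (CR + CS)) * X.norm f := by
        push_cast
        ring

end Interpolation

end RI

end

theorem mainTheorem2_general {α β : Type*} [MeasurableSpace α] [MeasurableSpace β]
    (μ : MeasureTheory.Measure α) (ν : MeasureTheory.Measure β)
    (hμ : RI.Nonatomic μ) (hν : RI.Nonatomic ν)
    (p₀ q₀ p₁ q : ℝ) (hp₀ : 1 < p₀) (hq : p₀ < q) (hp₁ : 0 < p₁) (hq₀ : 1 ≤ q₀)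
    (X : RI.RINorm μ) (Y : RI.RINorm ν)
    (hX : ∀ f : α →ₘ[μ] ℝ, X.norm f < ⊤ → f ∈ RI.lorentzSum μ p₀ q₀ q) :
    List.TFAE [
      ∀ T : (α →ₘ[μ] ℝ) → (β →ₘ[ν] ℝ), RI.Sublinear (RI.lorentzSum μ p₀ q₀ q) T →
        RI.EndpointBounds p₀ q₀ p₁ q T → RI.BoundedFrom X.norm (Y.angleNorm p₁) T,
      ∀ T : (α →ₘ[μ] ℝ) → (β →ₘ[ν] ℝ), RI.Quasilinear (RI.lorentzSum μ p₀ q₀ q) T →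
        RI.EndpointBounds p₀ q₀ p₁ q T → RI.BoundedFrom X.norm (Y.angleNorm p₁) T,
      RI.BoundedRepr X Y (RI.calderonR (RI.halfLine μ) p₀ q₀ p₁ q) ∧
        RI.BoundedRepr X Y (RI.calderonS (RI.halfLine μ) p₀ p₁ q)] := by
  have hp₀_pos : 0 < p₀ := by linarith
  have hq₀_pos : 0 < q₀ := by linarith
  tfae_have 1 → 3 := fun h =>
    ⟨(RI.endpointFunctional_hardyR hp₀ hq hq₀).boundedRepr hμ hν hp₁.le hX h,
      (RI.endpointFunctional_hardyS hp₀ hq hq₀_pos).boundedRepr hμ hν hp₁.le hX h⟩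
  tfae_have 3 → 2 := fun h _ hT hTb =>
    RI.boundedFrom_of_boundedRepr hν hp₀_pos hq hp₁.le hq₀_pos h.1 h.2 hT hTb
  tfae_have 2 → 1 := fun h T hT hTb => h T ⟨1, le_rfl, hT⟩ hTb
  tfae_finish

theorem mainTheorem2 {α β : Type*} [MeasurableSpace α] [MeasurableSpace β]
    (μ : MeasureTheory.Measure α) (ν : MeasureTheory.Measure β)
    [MeasureTheory.SigmaFinite μ] [MeasureTheory.SigmaFinite ν]
    (hμ : RI.Nonatomic μ) (hν : RI.Nonatomic ν)
    (p₀ q₀ p₁ q : ℝ) (hp₀ : 1 < p₀) (hq : p₀ < q) (hp₁ : 1 < p₁) (hq₀ : 1 ≤ q₀)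
    (X : RI.RINorm μ) (Y : RI.RINorm ν)
    (hX : ∀ f : α →ₘ[μ] ℝ, X.norm f < ⊤ → f ∈ RI.lorentzSum μ p₀ q₀ q) :
    List.TFAE [
      ∀ T : (α →ₘ[μ] ℝ) → (β →ₘ[ν] ℝ), RI.Sublinear (RI.lorentzSum μ p₀ q₀ q) T →
        RI.EndpointBounds p₀ q₀ p₁ q T → RI.BoundedFrom X.norm (Y.angleNorm p₁) T,
      ∀ T : (α →ₘ[μ] ℝ) → (β →ₘ[ν] ℝ), RI.Quasilinear (RI.lorentzSum μ p₀ q₀ q) T →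
        RI.EndpointBounds p₀ q₀ p₁ q T → RI.BoundedFrom X.norm (Y.angleNorm p₁) T,
      RI.BoundedRepr X Y (RI.calderonR (RI.halfLine μ) p₀ q₀ p₁ q) ∧
        RI.BoundedRepr X Y (RI.calderonS (RI.halfLine μ) p₀ p₁ q)] :=
  mainTheorem2_general μ ν hμ hν p₀ q₀ p₁ q hp₀ hq (zero_lt_one.trans hp₁) hq₀ X Y hX
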